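/- Let $N,p\in\mathbb N$, $\mathbf z\in\mathbb R^N$, $\beta>0$, $q>1$, and let $\mathbf X\in\mathbb R^{N\times p}$ have no zero column. For $j=1,\dots,2p$ let $\mathbf x_j\in\mathbb R^N$ be the $j$-th column of $\mathbf X$ if $j\le p$ and the negative of the $(j-p)$-th column if $j>p$; let $\mathbf M_j:\mathbb R^p\to\mathbb R\times\mathbb R^N=\mathbb R^{N+1}$, $\mathbf M_j\mathbf b=(\mathbf x_j^\top\mathbf X\mathbf b,\ \mathbf X\mathbf b)$, let $\mathbf M_j^*$ be its adjoint, and let $$g_{(j,q)}(\eta,\mathbf y)=\begin{cases}\dfrac{\|\mathbf y-\mathbf z\|^q}{\beta(\eta-\mathbf x_j^\top\mathbf z)^{q-1}}&\text{if }\eta>\mathbf x_j^\top\mathbf z,\\ 0&\text{if }\mathbf y=\mathbf z\text{ and }\eta=\mathbf x_j^\top\mathbf z,\\ +\infty&\text{otherwise.}\end{cases}$$ Let $\Psi:\mathbb R^p\to\mathbb R$ be convex and Gâteaux differentiable with Lipschitz continuous gradient $\nabla\Psi$ on $\mathbb R^p$. Put $$\mathcal S_{(j,q)}=\operatorname*{argmin}_{\mathbf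 b\in\mathbb R^p}\big[g_{(j,q)}(\mathbf M_j\mathbf b)+\|\mathbf b\|_1\big],\qquad \Omega^{(j,q)}=\operatorname*{argmin}_{\mathbf b\in\mathcal S_{(j,q)}}\Psi(\mathbf b).$$ Let $\operatorname{prox}_f(x)$ denote the minimizer of $y\mapsto f(y)+\frac12\|y-x\|^2$, let $\Xi_j(\mathbf b,\mathbf c)=\mathbf b-\mathbf M_j^*(\mathbf I+\mathbf M_j\mathbf M_j^*)^{-1}(\mathbf M_j\mathbf b-\mathbf c)$, and define the type-I Douglas–Rachford splitting (DRS) operator $\mathbf T^{(j,q)}:\mathbb R^p\times\mathbb R^{N+1}\to\mathbb R^p\times\mathbb R^{N+1}$ by $\mathbf T^{(j,q)}(\mathbf b,\mathbf c)=(2\operatorname{prox}_{\|\cdot\|_1}(\mathbf b_{1/2})-\mathbf b_{1/2},\ 2\operatorname{prox}_{g_{(j,q)}}(\mathbf c_{1/2})-\mathbf c_{1/2})$, where $\mathbf p=\Xi_j(\mathbf b,\mathbf c)$ and $(\mathbf b_{1/2},\mathbf c_{1/2})=(2\mathbf p-\mathbf b,\ 2\mathbf M_j\mathbf p-\mathbf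 c)$. Then for every $j=1,\dots,2p$: (a) $\operatorname{Fix}(\mathbf T^{(j,q)})$ is bounded. (b) $\mathbf T^{(j,q)}$ is nonexpansive with $\operatorname{Fix}(\mathbf T^{(j,q)})\neq\varnothing$, $\Omega^{(j,q)}\ne\varnothing$, and $\Theta=\Psi\circ\Xi_j$ is Gâteaux differentiable. For all $\alpha\in(0,1)$, all nonnegative sequences $(\lambda_{n+1})_{n\in\mathbb N}$ with $\sum_n\lambda_{n+1}^2<\infty$ and $\sum_n\lambda_{n+1}=\infty$, and all $(\mathbf b_0,\mathbf c_0)\in\mathbb R^p\times\mathbb R^{N+1}$, the algorithm $$\begin{aligned}(\mathbf b_{n+1/2},\mathbf c_{n+1/2})&=(1-\alpha)(\mathbf b_n,\mathbf c_n)+\alpha\mathbf T^{(j,q)}(\mathbf b_n,\mathbf c_n),\\ \mathbf b^\star_{n+1}&=\mathbf b_{n+1/2}-\mathbf M_j^*(\mathbf I+\mathbf M_j\mathbf M_j^*)^{-1}(\mathbf M_j\mathbf b_{n+1/2}-\mathbf c_{n+1/2}),\\ \mathbf b_{n+1}&=\mathbf b_{n+1/2}-\lambda_{n+1}\big(\mathbf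 I-\mathbf M_j^*(\mathbf I+\mathbf M_j\mathbf M_j^*)^{-1}\mathbf M_j\big)\nabla\Psi(\mathbf b^\star_{n+1}),\\ \mathbf c_{n+1}&=\mathbf c_{n+1/2}-\lambda_{n+1}(\mathbf I+\mathbf M_j\mathbf M_j^*)^{-1}\mathbf M_j\nabla\Psi(\mathbf b^\star_{n+1})\end{aligned}$$ is the hybrid steepest descent method $\mathbf w_{n+1}=\mathbf T_\alpha(\mathbf w_n)-\lambda_{n+1}\nabla\Theta(\mathbf T_\alpha(\mathbf w_n))$ for $\mathbf w_n=(\mathbf b_n,\mathbf c_n)$ and $\mathbf T_\alpha=(1-\alpha)\mathbf I+\alpha\mathbf T^{(j,q)}$, and it satisfies $\lim_{n\to\infty}d_{\Omega^{(j,q)}}(\mathbf b^\star_n)=0$, where $d_{\Omega}$ is the Euclidean distance to $\Omega$. -/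

import Mathlib

noncomputable section

namespace HTREX

open scoped NNReal InnerProductSpace

/-- The Euclidean space `ℝ^n`. -/
abbrev Euc (n : ℕ) : Type := EuclideanSpace ℝ (Fin n)

/-- The Hilbert space `ℝ × ℝ^N`, i.e. `ℝ^(N+1)` with its Euclidean norm. -/
abbrev DataSp (N : ℕ) : Type := WithLp 2 (ℝ × Euc N)

/-- The product Hilbert space `ℝ^p × ℝ^(N+1)`. -/
abbrev ProdSp (N p : ℕ) : Type := WithLp 2 (Euc p × DataSp N)

/-- The set of (global) minimizers of an extended-real-valued function. -/
def argminSet {E : Type*} (f : E → EReal) : Set E := {x | ∀ y, f x ≤ f y}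

/-- The proximity operator: `prox f x` is the minimizer of `y ↦ f y + ‖y - x‖² / 2`
(unique and existing when `f` is proper, lower semicontinuous and convex). -/
def prox {E : Type*} [NormedAddCommGroup E] (f : E → EReal) (x : E) : E :=
  Classical.epsilon fun y => y ∈ argminSet fun w : E => f w + ((1 / 2 * ‖w - x‖ ^ 2 : ℝ) : EReal)

/-- `G` is the Gâteaux gradient of `f` on the whole space. -/
def IsGateauxGradient {E : Type*} [NormedAddCommGroup E] [InnerProductSpace ℝ E]
    (f : E → ℝ) (G : E → E) : Prop :=
  ∀ x h : E, HasLineDerivAt ℝ f ⟪G x, h⟫_ℝ x h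

/-- The `ℓ₁` norm on `ℝ^p`. -/
def l1 {p : ℕ} (b : Euc p) : ℝ := ∑ i, |b i|

variable {N p : ℕ}

/-- The vectors `x_j`, `j = 1, …, 2p`: the `p` columns of `X` followed by their negatives. -/
def xvec (X : Matrix (Fin N) (Fin p) ℝ) (j : Fin (2 * p)) : Euc N :=
  if h : (j : ℕ) < p then WithLp.toLp 2 (X.col ⟨j, h⟩)
  else -WithLp.toLp 2 (X.col ⟨(j : ℕ) - p, by omega⟩)

/-- `M_j : ℝ^p → ℝ × ℝ^N`, `b ↦ (x_jᵀ X b, X b)`. -/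
def Mop (X : Matrix (Fin N) (Fin p) ℝ) (j : Fin (2 * p)) : Euc p →L[ℝ] DataSp N :=
  LinearMap.toContinuousLinearMap
    { toFun := fun b =>
        WithLp.toLp 2 (⟪xvec X j, X.toEuclideanLin b⟫_ℝ, X.toEuclideanLin b)
      map_add' := fun a b => by simp only [map_add, inner_add_right]; rfl
      map_smul' := fun r b => by
        simp only [map_smul, real_inner_smul_right, RingHom.id_apply]; rfl }

/-- The function `g_(j,q) : ℝ × ℝ^N → (-∞, ∞]`. -/
def gfun (X : Matrix (Fin N) (Fin p) ℝ) (z : Euc N) (β q : ℝ) (j : Fin (2 * p))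
    (c : DataSp N) : EReal :=
  open Classical in
  if ⟪xvec X j, z⟫_ℝ < c.fst then
    ((‖c.snd - z‖ ^ q / (β * (c.fst - ⟪xvec X j, z⟫_ℝ) ^ (q - 1)) : ℝ) : EReal)
  else if c.snd = z ∧ c.fst = ⟪xvec X j, z⟫_ℝ then 0
  else ⊤

/-- The solution set `S_(j,q)` of the `j`-th subproblem:
minimize `g_(j,q)(M_j b) + ‖b‖₁` over `b ∈ ℝ^p`. -/
def solSet (X : Matrix (Fin N) (Fin p) ℝ) (z : Euc N) (β q : ℝ) (j : Fin (2 * p)) :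
    Set (Euc p) :=
  argminSet fun b : Euc p => gfun X z β q j (Mop X j b) + (l1 b : EReal)

/-- `Ω^(j,q)`: the minimizers of `Ψ` over `S_(j,q)`. -/
def omegaSet (X : Matrix (Fin N) (Fin p) ℝ) (z : Euc N) (β q : ℝ) (Ψ : Euc p → ℝ)
    (j : Fin (2 * p)) : Set (Euc p) :=
  {b | b ∈ solSet X z β q j ∧ ∀ b' ∈ solSet X z β q j, Ψ b ≤ Ψ b'}

/-- `(I + M_j M_j^*)⁻¹`. -/
def resolventInv (X : Matrix (Fin N) (Fin p) ℝ) (j : Fin (2 * p)) : DataSp N →L[ℝ] DataSp N :=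
  Ring.inverse (1 + Mop X j ∘L (Mop X j).adjoint)

/-- The inverse in `resolventInv` is a genuine one. -/
theorem isUnit_one_add_comp_adjoint (X : Matrix (Fin N) (Fin p) ℝ) (j : Fin (2 * p)) :
    IsUnit (1 + Mop X j ∘L (Mop X j).adjoint) := by
  refine ContinuousLinearMap.isUnit_of_forall_le_norm_inner_map _ (c := 1) one_pos fun x => ?_
  have h : ⟪(1 + Mop X j ∘L (Mop X j).adjoint) x, x⟫_ℝ = ‖x‖ ^ 2 + ‖(Mop X j).adjoint x‖ ^ 2 := by
    rw [add_apply, inner_add_left, one_apply_eq_self,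
      real_inner_self_eq_norm_sq, ContinuousLinearMap.comp_apply,
      ← ContinuousLinearMap.adjoint_inner_right, real_inner_self_eq_norm_sq]
  rw [h, Real.norm_of_nonneg (by positivity)]
  simp only [NNReal.coe_one, mul_one]
  nlinarith [sq_nonneg ‖(Mop X j).adjoint x‖]

/-- `(b, c) ↦ b - M_j^* (I + M_j M_j^*)⁻¹ (M_j b - c)`, the `ℝ^p`-component of the projection of
`(b, c)` onto the null space of `(b, c) ↦ M_j b - c`. -/
def Xi (X : Matrix (Fin N) (Fin p) ℝ) (j : Fin (2 * p)) (w : ProdSp N p) : Euc p :=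
  w.fst - (Mop X j).adjoint (resolventInv X j (Mop X j w.fst - w.snd))

/-- The Douglas-Rachford splitting operator of type I for the `j`-th subproblem. -/
def TDRS (X : Matrix (Fin N) (Fin p) ℝ) (z : Euc N) (β q : ℝ) (j : Fin (2 * p))
    (w : ProdSp N p) : ProdSp N p :=
  let pt : Euc p := Xi X j w
  let bh : Euc p := (2 : ℝ) • pt - w.fst
  let ch : DataSp N := (2 : ℝ) • Mop X j pt - w.snd
  WithLp.toLp 2
    ((2 : ℝ) • prox (fun b : Euc p => (l1 b : EReal)) bh - bh,
     (2 : ℝ) • prox (gfun X z β q j) ch - ch)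

/-- The averaged operator `(1 - α) I + α T`; it produces `(b_{n+1/2}, c_{n+1/2})` from
`(b_n, c_n)`. -/
def TAvg (X : Matrix (Fin N) (Fin p) ℝ) (z : Euc N) (β q α : ℝ) (j : Fin (2 * p))
    (w : ProdSp N p) : ProdSp N p :=
  (1 - α) • w + α • TDRS X z β q j w

/-- The iterates `(b_n, c_n)` of the algorithm, where `G` is the gradient of `Ψ`, `w₀` is the
starting point `(b_0, c_0)`, and the step size used at step `n` is `lam (n + 1)`. -/
def iter (X : Matrix (Fin N) (Fin p) ℝ) (z : Euc N) (β q α : ℝ) (lam : ℕ → ℝ)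
    (G : Euc p → Euc p) (j : Fin (2 * p)) (w₀ : ProdSp N p) : ℕ → ProdSp N p
  | 0 => w₀
  | n + 1 =>
    let half : ProdSp N p := TAvg X z β q α j (iter X z β q α lam G j w₀ n)
    let bstar : Euc p := Xi X j half
    WithLp.toLp 2
      (half.fst - lam (n + 1) •
        (G bstar - (Mop X j).adjoint (resolventInv X j (Mop X j (G bstar)))),
       half.snd - lam (n + 1) • resolventInv X j (Mop X j (G bstar)))

/-- `bstarSucc … n` is the output `b*_{n+1}` of the algorithm. -/
def bstarSucc (X : Matrix (Fin N) (Fin p) ℝ) (z : Euc N) (β q α : ℝ) (lam : ℕ → ℝ)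
    (G : Euc p → Euc p) (j : Fin (2 * p)) (w₀ : ProdSp N p) (n : ℕ) : Euc p :=
  Xi X j (TAvg X z β q α j (iter X z β q α lam G j w₀ n))

end HTREX

end

/-! Every `w` splits orthogonally as `(b, M b) + (M* u, -u)` with `b = Xi w` and `u = dualPart w`.
The operator `TDRS` flips the sign of the second summand and then reflects through the two proximity
operators, so it is nonexpansive. Its fixed points are exactly the `w` whose `(b, u)` is a
primal–dual pair: `u ∈ ∂g(M b)` and `-M* u ∈ ∂‖·‖₁(b)` (`mem_fixedPoints_TDRS_iff`).

Since no column of `X` vanishes, some `b₀` makes `g` bounded on a unit ball around `M b₀`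
(`exists_slater_point`). This Slater point bounds all dual solutions, while coercivity of the `ℓ₁`
norm bounds the primal ones; this gives (a). It also supplies a dual solution for every minimizer,
so `Xi` maps the fixed point set onto the solution set (`image_Xi_fixedPoints`), and sends
minimizers of `Θ` over the fixed points into `Ω`.

Convergence is then a finite-dimensional fact, `tendsto_infDist_hybridSteepestDescent`. The averaged
map strictly attracts towards the compact fixed point set, and compactness makes the gain uniform
away from it. A gradient step expands distances by at most a factor `1 + (λκ)²`, summably close to
one, so the iterates stay bounded and approach the fixed points. Near these but far from the
minimizers, `Θ` exceeds its minimum by a definite amount, so the squared distance to the minimizers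
drops by a multiple of `λ`; since `∑ λ = ∞`, it tends to zero. -/

noncomputable section

namespace HTREX

open scoped NNReal InnerProductSpace
open Filter Topology

/-! ### Subgradients and proximity operators of extended-real-valued functions -/

section ConvexAnalysis

variable {E : Type*} [NormedAddCommGroup E] [InnerProductSpace ℝ E]

/-- The epigraph of an extended-real-valued function. -/
def epi (f : E → EReal) : Set (E × ℝ) := {a | f a.1 ≤ (a.2 : EReal)}

/-- Nonnegative proper lower semicontinuous convex functions. -/
structure IsNonnegClosedConvex (f : E → EReal) : Prop where
  nonneg : ∀ x, 0 ≤ f x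
  closed : IsClosed (epi f)
  proper : ∃ x, f x ≠ ⊤
  convex : Convex ℝ (epi f)

/-- `v` is a subgradient of `f` at `y`, and `f y` is finite. -/
def IsSubgrad (f : E → EReal) (y v : E) : Prop :=
  ∃ r : ℝ, f y = r ∧ ∀ (w : E) (t : ℝ), f w ≤ t → r + ⟪v, w - y⟫_ℝ ≤ t

lemma eq_coe_of_nonneg_of_le {a : EReal} {t : ℝ} (h0 : 0 ≤ a) (h : a ≤ t) :
    ∃ r : ℝ, a = r ∧ 0 ≤ r ∧ r ≤ t := by
  induction a using EReal.rec with
  | bot => simp at h0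
  | top => simp at h
  | coe a => exact ⟨a, rfl, by exact_mod_cast h0, by exact_mod_cast h⟩

lemma eq_coe_of_nonneg_of_ne_top {a : EReal} (h0 : 0 ≤ a) (h : a ≠ ⊤) :
    ∃ r : ℝ, a = r ∧ 0 ≤ r := by
  induction a using EReal.rec with
  | bot => simp at h0
  | top => simp at h
  | coe a => exact ⟨a, rfl, by exact_mod_cast h0⟩

lemma mem_argminSet_add_iff {E : Type*} {f : E → EReal} (hnn : ∀ x, 0 ≤ f x) (hpr : ∃ x, f x ≠ ⊤)
    {h : E → ℝ} {y : E} :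
    y ∈ argminSet (fun x => f x + (h x : EReal)) ↔
      ∃ r : ℝ, f y = r ∧ ∀ (w : E) (t : ℝ), f w ≤ t → r + h y ≤ t + h w := by
  constructor
  · intro hy
    obtain ⟨x, hx⟩ := hpr
    obtain ⟨s, hs, -⟩ := eq_coe_of_nonneg_of_ne_top (hnn x) hx
    have hfy : f y ≠ ⊤ := by
      intro htop
      have := hy x
      simp only [htop, hs] at this
      rw [EReal.top_add_coe, ← EReal.coe_add] at this
      exact absurd this (not_le.2 (EReal.coe_lt_top _))
    obtain ⟨r, hr, -⟩ := eq_coe_of_nonneg_of_ne_top (hnn y) hfy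
    refine ⟨r, hr, fun w t hw => ?_⟩
    obtain ⟨s', hs', -, hst⟩ := eq_coe_of_nonneg_of_le (hnn w) hw
    have := hy w
    simp only [hr, hs'] at this
    have : r + h y ≤ s' + h w := by exact_mod_cast this
    linarith
  · rintro ⟨r, hr, H⟩ w
    simp only [hr]
    by_cases hw : f w = ⊤
    · rw [hw, EReal.top_add_coe]; exact le_top
    · obtain ⟨s, hs, -⟩ := eq_coe_of_nonneg_of_ne_top (hnn w) hw
      rw [hs]
      exact_mod_cast H w s hs.le

/-- Any competitor no worse than a fixed finite point lies in a compact truncation of the epigraph,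
where the continuous function `t + h x` attains its minimum. Working on the epigraph replaces lower
semicontinuity of `f` by closedness. -/
lemma argminSet_add_nonempty {E : Type*} [NormedAddCommGroup E] [ProperSpace E]
    {f : E → EReal} (hnn : ∀ x, 0 ≤ f x)
    (hcl : IsClosed (epi f)) (hpr : ∃ x, f x ≠ ⊤) {h : E → ℝ} (hc : Continuous h)
    (h0 : ∀ x, 0 ≤ h x) (hb : ∀ R, Bornology.IsBounded {x | h x ≤ R}) :
    (argminSet fun x => f x + (h x : EReal)).Nonempty := by
  obtain ⟨x₀, hx₀⟩ := hpr
  obtain ⟨r₀, hr₀, hr₀0⟩ := eq_coe_of_nonneg_of_ne_top (hnn x₀) hx₀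
  set R := r₀ + h x₀
  have hcomp : IsCompact {x | h x ≤ R} :=
    Metric.isCompact_of_isClosed_isBounded (isClosed_le hc continuous_const) (hb R)
  have hK : IsCompact (epi f ∩ ({x | h x ≤ R} ×ˢ Set.Icc 0 R)) :=
    (hcomp.prod isCompact_Icc).inter_left hcl
  have hmem : (x₀, r₀) ∈ epi f ∩ ({x | h x ≤ R} ×ˢ Set.Icc 0 R) := by
    have := h0 x₀
    refine ⟨hr₀.le, ?_, hr₀0, ?_⟩
    · simp only [Set.mem_ofPred_eq, R]; linarith
    · simp only [R]; linarith
  obtain ⟨⟨y, t⟩, ⟨hyt, -⟩, hmin⟩ := hK.exists_isMinOn ⟨_, hmem⟩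
    (f := fun a : E × ℝ => a.2 + h a.1) (by fun_prop)
  have hyt : f y ≤ t := hyt
  obtain ⟨r, hr, -, hrt⟩ := eq_coe_of_nonneg_of_le (hnn y) hyt
  refine ⟨y, (mem_argminSet_add_iff hnn ⟨x₀, hx₀⟩).2 ⟨r, hr, fun w s hw => ?_⟩⟩
  obtain ⟨s', hs', hs'0, hss⟩ := eq_coe_of_nonneg_of_le (hnn w) hw
  have hle : t + h y ≤ R := hmin hmem
  have := h0 w
  by_cases hwR : s' + h w ≤ R
  · have hw' : (w, s') ∈ epi f ∩ ({x | h x ≤ R} ×ˢ Set.Icc 0 R) := by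
      refine ⟨hs'.le, ?_, hs'0, ?_⟩
      · simp only [Set.mem_ofPred_eq]; linarith
      · linarith
    have : t + h y ≤ s' + h w := hmin hw'
    linarith
  · linarith

lemma IsNonnegClosedConvex.isSubgrad_of_mem_argminSet {f : E → EReal}
    (hf : IsNonnegClosedConvex f) {x y : E}
    (hy : y ∈ argminSet fun w : E => f w + ((1 / 2 * ‖w - x‖ ^ 2 : ℝ) : EReal)) :
    IsSubgrad f y (x - y) := by
  obtain ⟨r, hr, H⟩ := (mem_argminSet_add_iff hf.nonneg hf.proper).1 hy
  refine ⟨r, hr, fun w t hw => ?_⟩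
  -- Minimality is tested along the segment from `y` to `w`; after division by `s` the quadratic
  -- term keeps a factor `s` and can be made negligible.
  have key : ∀ s : ℝ, 0 < s → s ≤ 1 →
      r + ⟪x - y, w - y⟫_ℝ ≤ t + s * (1 / 2 * ‖w - y‖ ^ 2) := by
    intro s hs hs1
    have hmem := hf.convex (x := (y, r)) hr.le (y := (w, t)) hw (a := 1 - s) (b := s)
      (by linarith) hs.le (by ring)
    have h1 := H _ _ (show f ((1 - s) • y + s • w) ≤ (((1 - s) • r + s • t : ℝ) : EReal) from hmem)
    have e : (1 - s) • y + s • w - x = (y - x) + s • (w - y) := by module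
    have e2 : ⟪y - x, w - y⟫_ℝ = - ⟪x - y, w - y⟫_ℝ := by
      rw [← inner_neg_left, neg_sub]
    rw [e, norm_add_sq_real, real_inner_smul_right, norm_smul, Real.norm_of_nonneg hs.le, e2] at h1
    simp only [smul_eq_mul] at h1
    have : s * (r + ⟪x - y, w - y⟫_ℝ) ≤ s * (t + s * (1 / 2 * ‖w - y‖ ^ 2)) := by
      linarith
    exact le_of_mul_le_mul_left this hs
  by_contra! hlt
  set D := r + ⟪x - y, w - y⟫_ℝ - t with hD
  set Q := 1 / 2 * ‖w - y‖ ^ 2 with hQ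
  have hQ0 : 0 ≤ Q := by positivity
  have hD0 : 0 < D := by linarith
  -- This `s` is at most one and satisfies `s * Q < D`, which contradicts the assumed excess `D`.
  have h2 := key (D / (D + Q + 1) / 1) (by positivity)
    (by rw [div_one, div_le_one (by positivity)]; linarith)
  have h3 : D / (D + Q + 1) / 1 * Q < D := by
    rw [div_one, div_mul_eq_mul_div, div_lt_iff₀ (by positivity)]
    nlinarith
  linarith

lemma IsSubgrad.monotone {f : E → EReal} {y v y' v' : E} (h : IsSubgrad f y v)
    (h' : IsSubgrad f y' v') : 0 ≤ ⟪v - v', y - y'⟫_ℝ := by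
  obtain ⟨r, hr, H⟩ := h
  obtain ⟨r', hr', H'⟩ := h'
  have h1 := H y' r' hr'.le
  have h2 := H' y r hr.le
  have e : ⟪v, y' - y⟫_ℝ = - ⟪v, y - y'⟫_ℝ := by rw [← inner_neg_right, neg_sub]
  rw [inner_sub_left]
  linarith

lemma IsNonnegClosedConvex.isSubgrad_prox [ProperSpace E] {f : E → EReal}
    (hf : IsNonnegClosedConvex f) (x : E) : IsSubgrad f (prox f x) (x - prox f x) := by
  apply hf.isSubgrad_of_mem_argminSet
  have hne := argminSet_add_nonempty hf.nonneg hf.closed hf.proper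
    (h := fun w : E => 1 / 2 * ‖w - x‖ ^ 2) (by fun_prop) (fun w => by positivity) (fun R => by
      refine (Metric.isBounded_closedBall (x := x) (r := 2 * |R| + 1)).subset fun w hw => ?_
      simp only [Set.mem_ofPred_eq] at hw
      rw [Metric.mem_closedBall, dist_eq_norm]
      nlinarith [le_abs_self R, norm_nonneg (w - x), abs_nonneg R])
  exact Classical.epsilon_spec hne

lemma IsNonnegClosedConvex.prox_eq_iff [ProperSpace E] {f : E → EReal}
    (hf : IsNonnegClosedConvex f) {x y : E} : prox f x = y ↔ IsSubgrad f y (x - y) := by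
  constructor
  · rintro rfl; exact hf.isSubgrad_prox x
  · intro h
    have := (hf.isSubgrad_prox x).monotone h
    have e : x - prox f x - (x - y) = -(prox f x - y) := by abel
    rw [e, inner_neg_left, real_inner_self_eq_norm_sq] at this
    have h0 : ‖prox f x - y‖ = 0 := by nlinarith [norm_nonneg (prox f x - y)]
    exact sub_eq_zero.1 (norm_eq_zero.1 h0)

/-- With `a = y - y'` and `d` the difference of the subgradients, the claim is `‖a - d‖ ≤ ‖a + d‖`,
which is monotonicity `⟪d, a⟫ ≥ 0`. -/
lemma IsNonnegClosedConvex.norm_reflect_sub_le [ProperSpace E] {f : E → EReal}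
    (hf : IsNonnegClosedConvex f) (x x' : E) :
    ‖((2 : ℝ) • prox f x - x) - ((2 : ℝ) • prox f x' - x')‖ ≤ ‖x - x'‖ := by
  have h := (hf.isSubgrad_prox x).monotone (hf.isSubgrad_prox x')
  set y := prox f x
  set y' := prox f x'
  have e : ((2 : ℝ) • y - x) - ((2 : ℝ) • y' - x') = (y - y') - ((x - y) - (x' - y')) := by module
  have e' : x - x' = (y - y') + ((x - y) - (x' - y')) := by abel
  rw [← sq_le_sq₀ (norm_nonneg _) (norm_nonneg _), e, e', norm_sub_sq_real, norm_add_sq_real,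
    real_inner_comm]
  linarith

end ConvexAnalysis

/-! ### Fenchel–Rockafellar duality under Slater's condition -/

section Duality

variable {E F : Type*} [NormedAddCommGroup E] [InnerProductSpace ℝ E] [CompleteSpace E]
  [NormedAddCommGroup F] [InnerProductSpace ℝ F] [CompleteSpace F]

/-- Fenchel–Rockafellar duality: under Slater's condition a minimizer of `g ∘ M + h` comes with a
dual solution. -/
lemma exists_isSubgrad_of_minimizer {g : F → EReal} (hg : IsNonnegClosedConvex g)
    {h : E → ℝ} (hh : ConvexOn ℝ Set.univ h) (M : E →L[ℝ] F) {b₀ : E} {ρ G : ℝ} (hρ : 0 < ρ)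
    (hslater : ∀ y, ‖y‖ ≤ ρ → g (M b₀ + y) ≤ G) {b : E} {r : ℝ} (hr : g (M b) = r)
    (hmin : ∀ (w : E) (t : ℝ), g (M w) ≤ t → r + h b ≤ t + h w) :
    ∃ u : F, IsSubgrad g (M b) u ∧ ∀ w, h b + ⟪-M.adjoint u, w - b⟫_ℝ ≤ h w := by
  -- The strict epigraph of the perturbation function `y ↦ inf_w g (M w + y) + h w`. The optimal
  -- value point `(0, m)` lies outside it, and the slope of a separating hyperplane is the dual
  -- solution.
  set A : Set (F × ℝ) := {a | ∃ (w : E) (s : ℝ), g (M w + a.1) ≤ s ∧ s + h w < a.2} with hA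
  have hconv : Convex ℝ A := by
    rintro ⟨y₁, t₁⟩ ⟨w₁, s₁, h₁, h₁'⟩ ⟨y₂, t₂⟩ ⟨w₂, s₂, h₂, h₂'⟩ α β hα hβ hαβ
    refine ⟨α • w₁ + β • w₂, α * s₁ + β * s₂, ?_, ?_⟩
    · have := hg.convex (x := (M w₁ + y₁, s₁)) h₁ (y := (M w₂ + y₂, s₂)) h₂ hα hβ hαβ
      have this : g (α • (M w₁ + y₁) + β • (M w₂ + y₂)) ≤ ((α • s₁ + β • s₂ : ℝ) : EReal) := this
      have e : M (α • w₁ + β • w₂) + (α • (y₁, t₁) + β • (y₂, t₂)).1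
          = α • (M w₁ + y₁) + β • (M w₂ + y₂) := by
        simp only [map_add, map_smul, Prod.smul_mk, Prod.mk_add_mk]; module
      rw [e]; exact this
    · have h3 := hh.2 (Set.mem_univ w₁) (Set.mem_univ w₂) hα hβ hαβ
      simp only [smul_eq_mul, Prod.smul_mk, Prod.mk_add_mk] at h3 h₁' h₂' ⊢
      rcases hα.eq_or_lt with h0 | h0
      · subst h0
        have : β = 1 := by linarith
        subst this
        linarith
      · nlinarith [mul_lt_mul_of_pos_left h₁' h0, mul_le_mul_of_nonneg_left h₂'.le hβ]
  have hsub : Metric.ball (0 : F) ρ ×ˢ Set.Ioi (G + h b₀) ⊆ A := by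
    rintro ⟨y, t⟩ ⟨hy, ht⟩
    exact ⟨b₀, G, hslater y (by simpa using (mem_ball_zero_iff.1 hy).le), ht⟩
  have hsub' : Metric.ball (0 : F) ρ ×ˢ Set.Ioi (G + h b₀) ⊆ interior A :=
    interior_maximal hsub (Metric.isOpen_ball.prod isOpen_Ioi)
  set m := r + h b with hm
  have hnot : ((0 : F), m) ∉ A := by
    rintro ⟨w, s, h1, h2⟩
    simp only [add_zero] at h1
    have := hmin w s h1
    simp only at h2
    linarith
  obtain ⟨φ, hφ⟩ := geometric_hahn_banach_open_point hconv.interior isOpen_interior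
    (fun hmem => hnot (interior_subset hmem))
  have hne : (interior A).Nonempty :=
    ⟨(0, G + h b₀ + 1), hsub' ⟨Metric.mem_ball_self hρ, by simp⟩⟩
  have hφle : ∀ a ∈ A, φ a ≤ φ (0, m) := by
    intro a ha
    have hcl : a ∈ closure (interior A) := by
      rw [hconv.closure_interior_eq_closure_of_nonempty_interior hne]
      exact subset_closure ha
    exact closure_minimal (fun x hx => (hφ x hx).le)
      (isClosed_le φ.continuous continuous_const) hcl
  set k := φ (0, 1) with hk
  have hdec : ∀ (y : F) (t : ℝ), φ (y, t) = φ (y, 0) + k * t := by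
    intro y t
    have : (y, t) = (y, (0 : ℝ)) + t • ((0 : F), (1 : ℝ)) := by simp
    rw [this, map_add, map_smul, smul_eq_mul, mul_comm]
  have h00 : φ ((0 : F), (0 : ℝ)) = 0 := map_zero φ
  -- The hyperplane is not vertical: by Slater's condition a point directly above `(0, m)` is
  -- interior to `A`.
  have hkneg : k < 0 := by
    have h1 := hφ (0, max (G + h b₀) m + 1)
      (hsub' ⟨Metric.mem_ball_self hρ, by
        have := le_max_left (G + h b₀) m
        simp only [Set.mem_Ioi]; linarith⟩)
    rw [hdec, hdec 0 m, h00] at h1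
    have := le_max_right (G + h b₀) m
    by_contra! hk0
    nlinarith
  set ψ : F →L[ℝ] ℝ := φ.comp (ContinuousLinearMap.inl ℝ F ℝ) with hψ
  set u : F := (-k)⁻¹ • (InnerProductSpace.toDual ℝ F).symm ψ with hu
  have hinner : ∀ y, φ (y, 0) = -k * ⟪u, y⟫_ℝ := by
    intro y
    rw [hu, real_inner_smul_left, InnerProductSpace.toDual_symm_apply, ← mul_assoc,
      mul_inv_cancel₀ (by linarith), one_mul]
    simp [hψ]
  have main : ∀ (y : F) (w : E) (s : ℝ), g (M w + y) ≤ s → m + ⟪u, y⟫_ℝ ≤ s + h w := by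
    intro y w s hs
    refine le_of_forall_pos_lt_add fun ε hε => ?_
    have h1 := hφle (y, s + h w + ε / 2) ⟨w, s, hs, by simp only; linarith⟩
    rw [hdec, hdec 0 m, h00, hinner] at h1
    have : -k * (m + ⟪u, y⟫_ℝ) ≤ -k * (s + h w + ε / 2) := by linarith
    have := le_of_mul_le_mul_left this (by linarith)
    linarith
  -- Keeping `w = b` and varying the perturbation gives the subgradient of `g`; the perturbation `M
  -- b - M w`, which freezes the argument of `g`, gives that of `h`.
  refine ⟨u, ⟨r, hr, fun c t hc => ?_⟩, fun w => ?_⟩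
  · have := main (c - M b) b t (by rwa [add_sub_cancel])
    linarith
  · have := main (M b - M w) w r (by rw [add_sub_cancel]; exact hr.le)
    rw [inner_neg_left, ContinuousLinearMap.adjoint_inner_left, map_sub, ← neg_sub (M b) (M w),
      inner_neg_right]
    linarith

/-- Dual solutions are bounded in terms of a Slater point. -/
lemma norm_mul_le_of_isSubgrad {g : F → EReal} {h : E → ℝ} (M : E →L[ℝ] F) {b₀ : E} {ρ G : ℝ}
    (hρ : 0 < ρ) (hslater : ∀ y, ‖y‖ ≤ ρ → g (M b₀ + y) ≤ G) (hnn : ∀ y, 0 ≤ g y)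
    (h0 : ∀ w, 0 ≤ h w) {b : E} {u : F} (hu : IsSubgrad g (M b) u)
    (hb : ∀ w, h b + ⟪-M.adjoint u, w - b⟫_ℝ ≤ h w) : ρ * ‖u‖ ≤ G + h b₀ := by
  obtain ⟨r, hr, H⟩ := hu
  have hr0 : 0 ≤ r := by have := hnn (M b); rw [hr] at this; exact_mod_cast this
  have h1 := hb b₀
  rw [inner_neg_left, ContinuousLinearMap.adjoint_inner_left, map_sub] at h1
  have h2 := h0 b
  -- The point of the Slater ball furthest in the direction `u`, so that the subgradient inequality
  -- picks up `ρ * ‖u‖`; for `u = 0` it is simply zero.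
  set y : F := (ρ * ‖u‖⁻¹) • u
  have hy : ‖y‖ ≤ ρ := by
    simp only [y, norm_smul, norm_mul, norm_inv, norm_norm, Real.norm_of_nonneg hρ.le]
    rw [mul_assoc]
    exact mul_le_of_le_one_right hρ.le (inv_mul_le_one_of_le₀ le_rfl (norm_nonneg _))
  have h3 := H _ _ (hslater y hy)
  have e : M b₀ + y - M b = (M b₀ - M b) + y := by abel
  have e2 : ⟪u, y⟫_ℝ = ρ * ‖u‖ := by
    simp only [y, real_inner_smul_right, real_inner_self_eq_norm_sq]
    by_cases hu0 : ‖u‖ = 0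
    · simp [hu0]
    · field_simp
  rw [e, inner_add_right, e2] at h3
  linarith

end Duality

/-! ### The hybrid steepest descent method in finite dimension -/

section HybridSteepestDescent

lemma mem_cthickening_iff_infDist_le {α : Type*} [PseudoMetricSpace α] {s : Set α} {δ : ℝ} {x : α}
    (hδ : 0 ≤ δ) (hs : s.Nonempty) : x ∈ Metric.cthickening δ s ↔ Metric.infDist x s ≤ δ := by
  rw [Metric.mem_cthickening_iff, Metric.infDist,
    ← ENNReal.le_ofReal_iff_toReal_le (Metric.infEDist_ne_top hs) hδ]

/-- Divergence of `∑ μ` forces the sequence below `ε` at some late index; from then on it either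
stays put or falls, or jumps to at most `2 * ε`. -/
lemma tendsto_zero_of_conditional_decrease {a μ : ℕ → ℝ} (ha : ∀ n, 0 ≤ a n)
    (hμ : ∀ n, 0 ≤ μ n) (hsum : ¬ Summable μ)
    (h : ∀ ε > 0, ∃ η > 0, ∀ᶠ n in atTop,
      (ε ≤ a n → a (n + 1) ≤ a n - η * μ n) ∧ (a n < ε → a (n + 1) ≤ 2 * ε)) :
    Tendsto a atTop (𝓝 0) := by
  rw [Metric.tendsto_atTop]
  intro ε hε
  obtain ⟨η, hη, hev⟩ := h (ε / 4) (by positivity)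
  obtain ⟨n₀, hn₀⟩ := eventually_atTop.1 hev
  have hhit : ∃ n ≥ n₀, a n < ε / 4 := by
    by_contra! hcon
    apply hsum
    rw [← summable_nat_add_iff n₀]
    refine summable_of_sum_range_le (c := a n₀ / η) (fun n => hμ _) fun n => ?_
    have : η * ∑ i ∈ Finset.range n, μ (i + n₀) ≤ a n₀ - a (n + n₀) := by
      induction n with
      | zero => simp
      | succ n ih =>
        have h1 := (hn₀ (n + n₀) (by omega)).1 (hcon _ (by omega))
        rw [Finset.sum_range_succ, mul_add, show n + 1 + n₀ = n + n₀ + 1 by ring]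
        linarith
    rw [le_div_iff₀ hη]
    have := ha (n + n₀)
    linarith
  obtain ⟨n₁, hn₁, hlt⟩ := hhit
  refine ⟨n₁, fun n hn => ?_⟩
  have : a n ≤ 2 * (ε / 4) := by
    induction n, hn using Nat.le_induction with
    | base => linarith
    | succ n hn ih =>
      obtain ⟨h1, h2⟩ := hn₀ n (by omega)
      by_cases hc : a n < ε / 4
      · exact h2 hc
      · have := h1 (not_lt.1 hc)
        have := mul_nonneg hη.le (hμ n)
        linarith
  rw [Real.dist_eq, sub_zero, abs_of_nonneg (ha n)]
  linarith

/-- The growth factors multiply to at most `exp (∑ ε)`. -/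
lemma bounded_of_le_one_add_mul {m ε : ℕ → ℝ} {n₀ : ℕ} (hm : ∀ n, 0 ≤ m n) (hε : ∀ n, 0 ≤ ε n)
    (hsum : Summable ε) (h : ∀ n ≥ n₀, m (n + 1) ≤ (1 + ε n) * m n) :
    ∃ B, ∀ n ≥ n₀, m n ≤ B := by
  refine ⟨m n₀ * Real.exp (∑' n, ε n), fun n hn => ?_⟩
  have key : m n ≤ m n₀ * Real.exp (∑ i ∈ Finset.range n, ε i) := by
    induction n, hn using Nat.le_induction with
    | base =>
      exact le_mul_of_one_le_right (hm _)
        (Real.one_le_exp (Finset.sum_nonneg fun i _ => hε i))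
    | succ n hn ih =>
      rw [Finset.sum_range_succ, Real.exp_add]
      calc m (n + 1) ≤ (1 + ε n) * m n := h n hn
        _ ≤ Real.exp (ε n) * (m n₀ * Real.exp (∑ i ∈ Finset.range n, ε i)) := by
          have := Real.add_one_le_exp (ε n)
          have := hε n
          exact mul_le_mul (by linarith) ih (hm n) (Real.exp_pos _).le
        _ = _ := by ring
  exact key.trans (mul_le_mul_of_nonneg_left
    (Real.exp_le_exp.2 (hsum.sum_le_tsum _ fun i _ => hε i)) (hm _))

variable {E : Type*} [NormedAddCommGroup E] [InnerProductSpace ℝ E]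

/-- With `d = T x - x`, nonexpansiveness towards the fixed point `y` says `2⟪x - y, d⟫ ≤ -‖d‖²`;
this is inserted in the expansion of `‖x - y + α d‖²`. -/
lemma norm_average_sub_sq_le {T : E → E} (hT : LipschitzWith 1 T) {α : ℝ} (hα : 0 ≤ α) {x y : E}
    (hy : T y = y) :
    ‖(1 - α) • x + α • T x - y‖ ^ 2 ≤ ‖x - y‖ ^ 2 - α * (1 - α) * ‖T x - x‖ ^ 2 := by
  have h1 : ‖T x - y‖ ≤ ‖x - y‖ := by
    have := hT.dist_le_mul x y
    rwa [hy, dist_eq_norm, dist_eq_norm, NNReal.coe_one, one_mul] at this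
  have e1 : (1 - α) • x + α • T x - y = (x - y) + α • (T x - x) := by module
  have e2 : T x - y = (x - y) + (T x - x) := by abel
  rw [e1, norm_add_sq_real, real_inner_smul_right, norm_smul, mul_pow, Real.norm_eq_abs, sq_abs]
  rw [← sq_le_sq₀ (norm_nonneg _) (norm_nonneg _), e2, norm_add_sq_real] at h1
  nlinarith

/-- A nonexpansive map which is strictly attracting towards a compact set `F` of fixed points
decreases the distance to `F` uniformly away from `F`. -/
lemma exists_infDist_decrease [ProperSpace E] {S : E → E} (hS : LipschitzWith 1 S) {F : Set E}
    (hF : IsCompact F) (hne : F.Nonempty)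
    (hstrict : ∀ x ∉ F, ∀ y ∈ F, dist (S x) y < dist x y) {r : ℝ} (hr : 0 < r) :
    ∃ D > 0, ∀ x, r ≤ Metric.infDist x F →
      Metric.infDist (S x) F ≤ Metric.infDist x F - D := by
  have hcont : Continuous fun x => Metric.infDist x F := Metric.continuous_infDist_pt F
  set K : Set E := {x | Metric.infDist x F = r} with hKdef
  -- Moving from `x` straight towards its nearest point of `F` reaches the compact shell `K`. The
  -- gain found on the shell carries over to `x` because `S` is nonexpansive.
  have hscale : ∀ x, r ≤ Metric.infDist x F → ∃ x' ∈ K,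
      dist x x' ≤ Metric.infDist x F - r := by
    intro x hx
    obtain ⟨y, hy, hxy⟩ := hF.exists_infDist_eq_dist hne x
    set ρ := Metric.infDist x F
    have hρ : 0 < ρ := hr.trans_le hx
    have hnx : ‖x - y‖ = ρ := by rw [hxy, dist_eq_norm]
    have hd : dist x (y + (r / ρ) • (x - y)) = ρ - r := by
      have e : x - (y + (r / ρ) • (x - y)) = (1 - r / ρ) • (x - y) := by module
      rw [dist_eq_norm, e, norm_smul, Real.norm_of_nonneg
        (by rw [sub_nonneg, div_le_one hρ]; exact hx), hnx]
      field_simp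
    refine ⟨y + (r / ρ) • (x - y), ?_, hd.le⟩
    · apply le_antisymm
      · refine (Metric.infDist_le_dist_of_mem hy).trans ?_
        rw [dist_eq_norm, add_sub_cancel_left, norm_smul, Real.norm_of_nonneg (by positivity), hnx]
        field_simp
        exact le_rfl
      · have := Metric.infDist_le_infDist_add_dist (s := F) (x := x)
          (y := y + (r / ρ) • (x - y))
        rw [hd] at this
        change ρ ≤ _ at this
        linarith
  have hKc : IsCompact K := by
    refine Metric.isCompact_of_isClosed_isBounded (isClosed_eq hcont continuous_const) ?_
    refine (hF.isBounded.cthickening (δ := r)).subset fun x hx => ?_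
    exact (mem_cthickening_iff_infDist_le hr.le hne).2 (le_of_eq hx)
  by_cases hKe : K.Nonempty
  · obtain ⟨x₀, hx₀, hmin⟩ := hKc.exists_isMinOn hKe
      (f := fun x => r - Metric.infDist (S x) F)
      (continuous_const.sub (hcont.comp hS.continuous)).continuousOn
    refine ⟨r - Metric.infDist (S x₀) F, ?_, fun x hx => ?_⟩
    · obtain ⟨y, hy, hxy⟩ := hF.exists_infDist_eq_dist hne x₀
      have hx₀' : Metric.infDist x₀ F = r := hx₀
      have hnot : x₀ ∉ F := fun hmem => by
        rw [Metric.infDist_zero_of_mem hmem] at hx₀'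
        exact hr.ne hx₀'
      have h1 := hstrict x₀ hnot y hy
      have h2 := Metric.infDist_le_dist_of_mem (x := S x₀) hy
      rw [← hxy, hx₀'] at h1
      linarith
    · obtain ⟨x', hx', hd⟩ := hscale x hx
      have h1 : r - Metric.infDist (S x₀) F ≤ r - Metric.infDist (S x') F := hmin hx'
      have h2 := Metric.infDist_le_infDist_add_dist (s := F) (x := S x) (y := S x')
      have h3 := hS.dist_le_mul x x'
      rw [NNReal.coe_one, one_mul] at h3
      linarith
  · refine ⟨1, one_pos, fun x hx => ?_⟩
    obtain ⟨x', hx', -⟩ := hscale x hx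
    exact absurd ⟨x', hx'⟩ hKe

/-- Away from the minimizers of `Θ` over `F`, but close to `F`, the function `Θ` exceeds its minimum
over `F` by a definite amount. -/
lemma exists_gap_near_of_far_from_argmin {E : Type*} [MetricSpace E] [ProperSpace E] {F Γ : Set E} (hF : IsCompact F)
    (hne : F.Nonempty) {Θ : E → ℝ} (hΘ : Continuous Θ) {m : ℝ}
    (hm : ∀ x ∈ F, m ≤ Θ x) (hΓ : ∀ x ∈ F, Θ x = m → x ∈ Γ) {e : ℝ} (he : 0 < e) :
    ∃ η > 0, ∃ ρ > 0, ∀ x, Metric.infDist x F ≤ ρ → e ≤ Metric.infDist x Γ → m + η ≤ Θ x := by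
  set K : Set E := {x | Metric.infDist x F ≤ 1 ∧ e ≤ Metric.infDist x Γ}
  have hcF : Continuous fun x => Metric.infDist x F := Metric.continuous_infDist_pt F
  have hcΓ : Continuous fun x => Metric.infDist x Γ := Metric.continuous_infDist_pt Γ
  have hKc : IsCompact K := by
    refine Metric.isCompact_of_isClosed_isBounded
      ((isClosed_le hcF continuous_const).inter (isClosed_le continuous_const hcΓ)) ?_
    refine (hF.isBounded.cthickening (δ := 1)).subset fun x hx => ?_
    exact (mem_cthickening_iff_infDist_le zero_le_one hne).2 hx.1
  by_cases hKe : K.Nonempty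
  -- The maximum below is nonpositive only at points of `F` with value at most `m`, hence in `Γ`,
  -- which `K` avoids.
  · obtain ⟨x₀, hx₀, hmin⟩ := hKc.exists_isMinOn hKe
      (f := fun x => max (Metric.infDist x F) (Θ x - m))
      (hcF.max (hΘ.sub continuous_const)).continuousOn
    set c := max (Metric.infDist x₀ F) (Θ x₀ - m) with hc
    have hc0 : 0 < c := by
      by_contra! hle
      have h1 : Metric.infDist x₀ F ≤ 0 := (le_max_left _ _).trans hle
      have h2 : Θ x₀ - m ≤ 0 := (le_max_right _ _).trans hle
      have hmem : x₀ ∈ F := (hF.isClosed.mem_iff_infDist_zero hne).2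
        (le_antisymm h1 Metric.infDist_nonneg)
      have := hΓ x₀ hmem (le_antisymm (by linarith) (hm x₀ hmem))
      have h3 := hx₀.2
      rw [Metric.infDist_zero_of_mem this] at h3
      linarith
    refine ⟨c, hc0, min 1 (c / 2), by positivity, fun x hx hxe => ?_⟩
    have h1 : c ≤ max (Metric.infDist x F) (Θ x - m) :=
      hmin (show x ∈ K from ⟨hx.trans (min_le_left _ _), hxe⟩)
    have h2 := hx.trans (min_le_right _ _)
    rcases le_max_iff.1 h1 with h | h <;> linarith
  · refine ⟨1, one_pos, 1, one_pos, fun x hx hxe => ?_⟩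
    exact absurd ⟨x, hx, hxe⟩ hKe

/-- Convergence of the hybrid steepest descent method for a strictly attracting nonexpansive map
with a bounded fixed point set on a finite-dimensional space. -/
theorem tendsto_infDist_hybridSteepestDescent [FiniteDimensional ℝ E] {S : E → E}
    (hS : LipschitzWith 1 S) {F : Set E} (hF : IsCompact F) (hfix : ∀ x ∈ F, S x = x)
    (hstrict : ∀ x ∉ F, ∀ y ∈ F, dist (S x) y < dist x y)
    {Θ : E → ℝ} (hΘ : Continuous Θ) {G : E → E} {κ : ℝ≥0} (hG : LipschitzWith κ G)
    (hgrad : ∀ x y, Θ x + ⟪G x, y - x⟫_ℝ ≤ Θ y)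
    {Γ : Set E} (hΓ : ∀ x, x ∈ Γ ↔ x ∈ F ∧ ∀ y ∈ F, Θ x ≤ Θ y) (hΓne : Γ.Nonempty)
    {lam : ℕ → ℝ} (hlam : ∀ n, 0 ≤ lam n) (hlam2 : Summable fun n => lam n ^ 2)
    (hlam1 : ¬ Summable lam) {w : ℕ → E} (hw : ∀ n, w (n + 1) = S (w n) - lam n • G (S (w n))) :
    Tendsto (fun n => Metric.infDist (w n) Γ) atTop (𝓝 0) := by
  have : ProperSpace E := FiniteDimensional.proper ℝ E
  have hΓF : Γ ⊆ F := fun x hx => ((hΓ x).1 hx).1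
  have hne : F.Nonempty := hΓne.mono hΓF
  have hlam0 : Tendsto lam atTop (𝓝 0) := by
    have h1 := hlam2.tendsto_atTop_zero
    have h2 := (Real.continuous_sqrt.tendsto 0).comp h1
    rw [Real.sqrt_zero] at h2
    refine h2.congr fun n => ?_
    simp [Real.sqrt_sq (hlam n)]
  have hmono : ∀ x y, 0 ≤ ⟪G x - G y, x - y⟫_ℝ := by
    intro x y
    have h1 := hgrad x y
    have h2 := hgrad y x
    have e : ⟪G x, y - x⟫_ℝ = - ⟪G x, x - y⟫_ℝ := by rw [← inner_neg_right, neg_sub]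
    rw [inner_sub_left]
    linarith
  have hGn : ∀ x y, ‖G x - G y‖ ≤ κ * ‖x - y‖ := fun x y => hG.norm_sub_le x y
  have hSn : ∀ x y, ‖S x - S y‖ ≤ ‖x - y‖ := fun x y => by
    simpa using hS.norm_sub_le x y
  -- gradient steps expand by at most `1 + (λκ)²`
  have hstep : ∀ (t : ℝ), 0 ≤ t → ∀ x y,
      ‖(x - t • G x) - (y - t • G y)‖ ≤ (1 + t ^ 2 * κ ^ 2) * ‖x - y‖ := by
    intro t ht x y
    have e : (x - t • G x) - (y - t • G y) = (x - y) - t • (G x - G y) := by module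
    rw [← sq_le_sq₀ (norm_nonneg _) (by positivity), e, norm_sub_sq_real, real_inner_smul_right,
      norm_smul, Real.norm_of_nonneg ht, real_inner_comm]
    have h1 := mul_nonneg ht (hmono x y)
    have h2 : (t * ‖G x - G y‖) ^ 2 ≤ (t * (κ * ‖x - y‖)) ^ 2 := by
      gcongr; exact hGn x y
    have h3 : 0 ≤ (t ^ 2 * (κ : ℝ) ^ 2) * ‖x - y‖ ^ 2 := by positivity
    have h4 : 0 ≤ (t ^ 2 * (κ : ℝ) ^ 2) ^ 2 * ‖x - y‖ ^ 2 := by positivity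
    have e2 : ((1 + t ^ 2 * (κ : ℝ) ^ 2) * ‖x - y‖) ^ 2 = ‖x - y‖ ^ 2
      + 2 * ((t ^ 2 * (κ : ℝ) ^ 2) * ‖x - y‖ ^ 2) + (t ^ 2 * (κ : ℝ) ^ 2) ^ 2 * ‖x - y‖ ^ 2 := by
      ring
    have e3 : (t * (κ * ‖x - y‖)) ^ 2 = (t ^ 2 * (κ : ℝ) ^ 2) * ‖x - y‖ ^ 2 := by ring
    rw [e2]
    rw [e3] at h2
    linarith
  obtain ⟨C, hC⟩ := hF.exists_bound_of_continuousOn hG.continuous.continuousOn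
  obtain ⟨x₁, hx₁⟩ := hne
  have hC0 : 0 ≤ C := (norm_nonneg _).trans (hC x₁ hx₁)
  have hrec : ∀ n, Metric.infDist (w (n + 1)) F ≤
      (1 + lam n ^ 2 * κ ^ 2) * Metric.infDist (S (w n)) F + lam n * C := by
    intro n
    obtain ⟨y, hy, hxy⟩ := hF.exists_infDist_eq_dist ⟨x₁, hx₁⟩ (S (w n))
    refine (Metric.infDist_le_dist_of_mem hy).trans ?_
    rw [hxy, dist_eq_norm, dist_eq_norm, hw]
    have e : S (w n) - lam n • G (S (w n)) - y =
      ((S (w n) - lam n • G (S (w n))) - (y - lam n • G y)) - lam n • G y := by abel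
    rw [e]
    refine (norm_sub_le _ _).trans (add_le_add (hstep _ (hlam n) _ _) ?_)
    rw [norm_smul, Real.norm_of_nonneg (hlam n)]
    exact mul_le_mul_of_nonneg_left (hC y hy) (hlam n)
  have hSd : ∀ x, Metric.infDist (S x) F ≤ Metric.infDist x F := by
    intro x
    obtain ⟨y, hy, hxy⟩ := hF.exists_infDist_eq_dist ⟨x₁, hx₁⟩ x
    refine (Metric.infDist_le_dist_of_mem hy).trans ?_
    have := hS.dist_le_mul x y
    rwa [hfix y hy, NNReal.coe_one, one_mul, ← hxy] at this
  have hlamC : ∀ c > 0, ∀ᶠ n in atTop, lam n * C < c := by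
    intro c hc
    have : Tendsto (fun n => lam n * C) atTop (𝓝 (0 * C)) := hlam0.mul_const C
    rw [zero_mul] at this
    exact this.eventually_lt_const hc
  have hsumκ : Summable fun n => lam n ^ 2 * (κ : ℝ) ^ 2 := hlam2.mul_right _
  -- boundedness of the distance to `F`
  obtain ⟨B, hB0, hB⟩ : ∃ B, 0 < B ∧ ∀ᶠ n in atTop, Metric.infDist (w n) F ≤ B := by
    obtain ⟨D, hD, hdec⟩ := exists_infDist_decrease hS hF ⟨x₁, hx₁⟩ hstrict one_pos
    obtain ⟨n₀, hn₀⟩ := eventually_atTop.1 (hlamC (min D 1) (by positivity))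
    -- Truncation at `2` absorbs the additive error `lam n * C`: at distance at least `1` the gain
    -- `D` outweighs it, and at distance below `1` the error is less than `1`.
    obtain ⟨B, hB⟩ := bounded_of_le_one_add_mul (n₀ := n₀)
      (m := fun n => max (Metric.infDist (w n) F) 2) (ε := fun n => lam n ^ 2 * (κ : ℝ) ^ 2)
      (fun n => le_max_of_le_right zero_le_two) (fun n => by positivity) hsumκ (fun n hn => by
        have h1 := hrec n
        have h2 := hn₀ n hn
        have h3 : lam n * C < D := h2.trans_le (min_le_left _ _)
        have h4 : lam n * C < 1 := h2.trans_le (min_le_right _ _)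
        have hε : 0 ≤ lam n ^ 2 * (κ : ℝ) ^ 2 := by positivity
        have hm1 := le_max_left (Metric.infDist (w n) F) 2
        have hm2 := le_max_right (Metric.infDist (w n) F) 2
        apply max_le
        · by_cases hc : 1 ≤ Metric.infDist (w n) F
          · have h5 := hdec _ hc
            nlinarith
          · have h5 := hSd (w n)
            push Not at hc
            nlinarith
        · nlinarith)
    refine ⟨max B 1, by positivity, eventually_atTop.2 ⟨n₀, fun n hn => ?_⟩⟩
    exact ((le_max_left _ _).trans (hB n hn)).trans (le_max_left _ _)
  have hsmall : ∀ c > 0, ∀ᶠ n in atTop, lam n ^ 2 * (κ : ℝ) ^ 2 * B + lam n * C < c := by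
    intro c hc
    have : Tendsto (fun n => lam n ^ 2 * (κ : ℝ) ^ 2 * B + lam n * C) atTop
        (𝓝 (0 * B + 0 * C)) :=
      (hsumκ.tendsto_atTop_zero.mul_const B).add (hlam0.mul_const C)
    rw [zero_mul, zero_mul, add_zero] at this
    exact this.eventually_lt_const hc
  -- Unit weights suffice here: the gain `D` away from `F` is fixed while the perturbation tends to
  -- zero.
  have hdF : Tendsto (fun n => Metric.infDist (w n) F) atTop (𝓝 0) := by
    refine tendsto_zero_of_conditional_decrease (μ := fun _ => (1 : ℝ))
      (fun n => Metric.infDist_nonneg) (fun _ => zero_le_one) (fun hs => ?_) fun ε hε => ?_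
    · exact one_ne_zero (tendsto_nhds_unique tendsto_const_nhds hs.tendsto_atTop_zero)
    · obtain ⟨D, hD, hdec⟩ := exists_infDist_decrease hS hF ⟨x₁, hx₁⟩ hstrict hε
      refine ⟨D / 2, by positivity, ?_⟩
      filter_upwards [hB, hsmall (D / 2) (by positivity), hsmall ε hε] with n hnB hn1 hn2
      have h1 := hrec n
      have h2 := hSd (w n)
      have hε' : 0 ≤ lam n ^ 2 * (κ : ℝ) ^ 2 := by positivity
      have h3 := mul_le_mul_of_nonneg_left (h2.trans hnB) hε'
      refine ⟨fun hc => ?_, fun hc => ?_⟩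
      · have h5 := hdec _ hc
        linarith
      · linarith
  -- convergence to the minimizers
  obtain ⟨y₀, hy₀⟩ := hΓne
  set m := Θ y₀
  have hmF : ∀ x ∈ F, m ≤ Θ x := ((hΓ y₀).1 hy₀).2
  have hΓm : ∀ x ∈ Γ, Θ x = m := fun x hx =>
    le_antisymm (((hΓ x).1 hx).2 y₀ (hΓF hy₀)) (hmF x (hΓF hx))
  have hΓmem : ∀ x ∈ F, Θ x = m → x ∈ Γ := fun x hx h =>
    (hΓ x).2 ⟨hx, fun y hy => h ▸ hmF y hy⟩
  have hΓc : IsCompact Γ := by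
    have : Γ = F ∩ {x | Θ x ≤ m} := by
      ext x
      refine ⟨fun hx => ⟨hΓF hx, (hΓm x hx).le⟩, fun hx => hΓmem x hx.1 ?_⟩
      exact le_antisymm hx.2 (hmF x hx.1)
    rw [this]
    exact hF.inter_right (isClosed_le hΘ continuous_const)
  obtain ⟨C', hC'⟩ := (hF.cthickening (r := B)).exists_bound_of_continuousOn
    hG.continuous.continuousOn
  have hmemB : ∀ᶠ n in atTop, S (w n) ∈ Metric.cthickening B F := by
    filter_upwards [hB] with n hn
    exact (mem_cthickening_iff_infDist_le hB0.le ⟨x₁, hx₁⟩).2 ((hSd _).trans hn)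
  have hrecΓ : ∀ᶠ n in atTop, Metric.infDist (w (n + 1)) Γ ^ 2 ≤
      Metric.infDist (w n) Γ ^ 2 - 2 * lam n * (Θ (S (w n)) - m) + lam n ^ 2 * C' ^ 2 := by
    filter_upwards [hmemB] with n hn
    obtain ⟨y, hy, hxy⟩ := hΓc.exists_infDist_eq_dist ⟨y₀, hy₀⟩ (w n)
    have h1 : Metric.infDist (w (n + 1)) Γ ^ 2 ≤ ‖w (n + 1) - y‖ ^ 2 := by
      rw [← dist_eq_norm]
      exact pow_le_pow_left₀ Metric.infDist_nonneg (Metric.infDist_le_dist_of_mem hy) 2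
    have h2 : ‖S (w n) - y‖ ^ 2 ≤ ‖w n - y‖ ^ 2 := by
      have := hSn (w n) y
      rw [hfix y (hΓF hy)] at this
      exact pow_le_pow_left₀ (norm_nonneg _) this 2
    have h3 := hgrad (S (w n)) y
    rw [hΓm y hy] at h3
    have e3 : ⟪G (S (w n)), y - S (w n)⟫_ℝ = - ⟪S (w n) - y, G (S (w n))⟫_ℝ := by
      rw [← neg_sub, inner_neg_right, real_inner_comm]
    have h4 : lam n ^ 2 * ‖G (S (w n))‖ ^ 2 ≤ lam n ^ 2 * C' ^ 2 := by
      gcongr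
      exact hC' _ hn
    rw [hxy, dist_eq_norm]
    have e : w (n + 1) - y = (S (w n) - y) - lam n • G (S (w n)) := by rw [hw]; abel
    rw [e, norm_sub_sq_real, real_inner_smul_right, norm_smul, Real.norm_of_nonneg (hlam n),
      mul_pow] at h1
    have h5 : lam n * (Θ (S (w n)) - m) ≤ lam n * ⟪S (w n) - y, G (S (w n))⟫_ℝ :=
      mul_le_mul_of_nonneg_left (by linarith) (hlam n)
    linarith
  -- `S (w n)` need not lie in `F`, so `Θ` may fall below `m` there, but only by a multiple of the
  -- vanishing distance to `F`.
  have hΘlow : ∀ c > 0, ∀ᶠ n in atTop, m - Θ (S (w n)) ≤ c := by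
    intro c hc
    have hbd : ∀ᶠ n in atTop, m - Θ (S (w n)) ≤ C' * Metric.infDist (w n) F := by
      filter_upwards [hmemB] with n hn
      obtain ⟨y, hy, hxy⟩ := hF.exists_infDist_eq_dist ⟨x₁, hx₁⟩ (w n)
      have h1 := hgrad y (S (w n))
      have h2 := hmF y hy
      have h3 := abs_le.1 (abs_real_inner_le_norm (G y) (S (w n) - y))
      have h4 : ‖S (w n) - y‖ ≤ ‖w n - y‖ := by
        have := hSn (w n) y
        rwa [hfix y hy] at this
      have h5 : ‖G y‖ ≤ C' := hC' y (Metric.self_subset_cthickening F hy)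
      rw [hxy, dist_eq_norm]
      have h6 : ‖G y‖ * ‖S (w n) - y‖ ≤ C' * ‖w n - y‖ :=
        mul_le_mul h5 h4 (norm_nonneg _) ((norm_nonneg _).trans h5)
      linarith [h3.1]
    have hlim : Tendsto (fun n => C' * Metric.infDist (w n) F) atTop (𝓝 (C' * 0)) :=
      hdF.const_mul C'
    rw [mul_zero] at hlim
    filter_upwards [hbd, hlim.eventually_lt_const hc] with n h1 h2
    linarith
  have hsq : Tendsto (fun n => Metric.infDist (w n) Γ ^ 2) atTop (𝓝 0) := by
    refine tendsto_zero_of_conditional_decrease (μ := lam)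
      (fun n => by positivity) hlam hlam1 fun ε hε => ?_
    -- If `w n` is at distance at least `√ε` from `Γ` and within `√ε / 4` of `F`, then `S` moves it
    -- by at most `√ε / 2`, so `S (w n)` remains `√ε / 2` away from `Γ`.
    obtain ⟨η, hη, ρ, hρ, hgap⟩ := exists_gap_near_of_far_from_argmin hF ⟨x₁, hx₁⟩ hΘ hmF hΓmem
      (e := Real.sqrt ε / 2) (by positivity)
    refine ⟨η, hη, ?_⟩
    have hl1 : ∀ᶠ n in atTop, lam n * C' ^ 2 < η := by
      have : Tendsto (fun n => lam n * C' ^ 2) atTop (𝓝 (0 * C' ^ 2)) := hlam0.mul_const _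
      rw [zero_mul] at this
      exact this.eventually_lt_const hη
    have hl2 : ∀ᶠ n in atTop, lam n * (2 + C' ^ 2) < ε := by
      have : Tendsto (fun n => lam n * (2 + C' ^ 2)) atTop (𝓝 (0 * (2 + C' ^ 2))) :=
        hlam0.mul_const _
      rw [zero_mul] at this
      exact this.eventually_lt_const hε
    filter_upwards [hrecΓ, hl1, hl2, hdF.eventually_lt_const hρ,
      hdF.eventually_lt_const (show 0 < Real.sqrt ε / 4 by positivity), hΘlow 1 one_pos,
      hlam0.eventually_lt_const one_pos] with n h1 h2 h3 h4 h5 h6 h7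
    refine ⟨fun hc => ?_, fun hc => ?_⟩
    · have hsε : Real.sqrt ε ≤ Metric.infDist (w n) Γ :=
        Real.sqrt_le_iff.2 ⟨Metric.infDist_nonneg, hc⟩
      have hmove : dist (w n) (S (w n)) ≤ 2 * Metric.infDist (w n) F := by
        obtain ⟨y, hy, hxy⟩ := hF.exists_infDist_eq_dist ⟨x₁, hx₁⟩ (w n)
        have h8 := hS.dist_le_mul (w n) y
        rw [hfix y hy, NNReal.coe_one, one_mul] at h8
        have h9 := dist_triangle_right (w n) (S (w n)) y
        rw [hxy]
        linarith
      have h10 := Metric.infDist_le_infDist_add_dist (s := Γ) (x := w n) (y := S (w n))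
      have h11 := hgap (S (w n)) ((hSd _).trans h4.le) (by linarith)
      have h12 : lam n * η ≤ lam n * (Θ (S (w n)) - m) :=
        mul_le_mul_of_nonneg_left (by linarith) (hlam n)
      have h13 : lam n * (lam n * C' ^ 2) ≤ lam n * η :=
        mul_le_mul_of_nonneg_left h2.le (hlam n)
      nlinarith
    · have h12 : lam n * (m - Θ (S (w n))) ≤ lam n * 1 :=
        mul_le_mul_of_nonneg_left h6 (hlam n)
      have h13 : lam n * (lam n * C' ^ 2) ≤ 1 * (lam n * C' ^ 2) :=
        mul_le_mul_of_nonneg_right h7.le (mul_nonneg (hlam n) (sq_nonneg _))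
      nlinarith
  have := (Real.continuous_sqrt.tendsto 0).comp hsq
  rw [Real.sqrt_zero] at this
  refine this.congr fun n => ?_
  simp [Real.sqrt_sq Metric.infDist_nonneg]

end HybridSteepestDescent

/-! ### The `ℓ₁` norm: convexity and coercivity -/

section L1Norm

variable {p : ℕ}

lemma continuous_l1 : Continuous (l1 : Euc p → ℝ) := by
  unfold l1
  fun_prop

lemma l1_nonneg (b : Euc p) : 0 ≤ l1 b := Finset.sum_nonneg fun _ _ => abs_nonneg _

lemma convexOn_l1 : ConvexOn ℝ Set.univ (l1 : Euc p → ℝ) := by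
  refine ⟨convex_univ, fun x _ y _ a b ha hb _ => ?_⟩
  simp only [l1, smul_eq_mul, Finset.mul_sum, ← Finset.sum_add_distrib]
  refine Finset.sum_le_sum fun i _ => ?_
  simp only [PiLp.add_apply, PiLp.smul_apply, smul_eq_mul]
  refine (abs_add_le _ _).trans (le_of_eq ?_)
  rw [abs_mul, abs_mul, abs_of_nonneg ha, abs_of_nonneg hb]

lemma norm_le_l1 (b : Euc p) : ‖b‖ ≤ l1 b := by
  rw [← sq_le_sq₀ (norm_nonneg _) (l1_nonneg b), EuclideanSpace.norm_sq_eq]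
  exact Finset.sum_sq_le_sq_sum_of_nonneg fun i _ => abs_nonneg _

lemma isBounded_l1_le (R : ℝ) : Bornology.IsBounded {b : Euc p | l1 b ≤ R} :=
  (Metric.isBounded_closedBall (x := 0) (r := R)).subset fun b hb =>
    mem_closedBall_zero_iff.2 ((norm_le_l1 b).trans hb)

lemma isNonnegClosedConvex_l1 :
    IsNonnegClosedConvex (fun b : Euc p => (l1 b : EReal)) where
  nonneg b := by exact_mod_cast l1_nonneg b
  closed := by
    simp only [epi, EReal.coe_le_coe_iff]
    exact isClosed_le (continuous_l1.comp continuous_fst) continuous_snd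
  proper := ⟨0, EReal.coe_ne_top _⟩
  convex := by
    simpa only [epi, EReal.coe_le_coe_iff, Set.mem_univ, true_and] using
      (convexOn_l1 (p := p)).convex_epigraph

lemma isSubgrad_l1_iff {b v : Euc p} : IsSubgrad (fun b : Euc p => (l1 b : EReal)) b v ↔
    ∀ w, l1 b + ⟪v, w - b⟫_ℝ ≤ l1 w := by
  constructor
  · rintro ⟨r, hr, H⟩ w
    have : l1 b = r := EReal.coe_eq_coe_iff.1 hr
    rw [this]
    exact H w _ le_rfl
  · intro H
    exact ⟨l1 b, rfl, fun w t hw => (H w).trans (EReal.coe_le_coe_iff.1 hw)⟩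

end L1Norm

/-! ### Convexity and closedness of the perspective function `g` -/

section Perspective

lemma rpow_le_mul_rpow_smul {q u t s c : ℝ} (hc : 0 ≤ c) (hq : 1 < q) (hu : 0 ≤ u)
    (hs : 0 ≤ s) (h : u ^ q ≤ t * s ^ (q - 1)) :
    (c * u) ^ q ≤ (c * t) * (c * s) ^ (q - 1) := by
  rcases hc.eq_or_lt with rfl | hc0
  · simp [Real.zero_rpow (show q ≠ 0 by linarith)]
  · rw [Real.mul_rpow hc hu, Real.mul_rpow hc hs]
    have e : c ^ q = c * c ^ (q - 1) := by
      rw [mul_comm, ← Real.rpow_add_one hc0.ne', sub_add_cancel]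
    rw [e]
    have : 0 ≤ c * c ^ (q - 1) := by positivity
    calc c * c ^ (q - 1) * u ^ q ≤ c * c ^ (q - 1) * (t * s ^ (q - 1)) :=
          mul_le_mul_of_nonneg_left h this
      _ = _ := by ring

/-- For positive `s₁, s₂` this is convexity of the power at `uᵢ / sᵢ` with weights `sᵢ / (s₁ + s₂)`;
a vanishing `sᵢ` forces `uᵢ = 0`. With the scaling lemma, the constraint defines a convex cone. -/
lemma rpow_le_mul_rpow_add {q u₁ t₁ s₁ u₂ t₂ s₂ : ℝ} (hq : 1 < q)
    (hu₁ : 0 ≤ u₁) (ht₁ : 0 ≤ t₁) (hs₁ : 0 ≤ s₁) (h₁ : u₁ ^ q ≤ t₁ * s₁ ^ (q - 1))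
    (hu₂ : 0 ≤ u₂) (ht₂ : 0 ≤ t₂) (hs₂ : 0 ≤ s₂) (h₂ : u₂ ^ q ≤ t₂ * s₂ ^ (q - 1)) :
    (u₁ + u₂) ^ q ≤ (t₁ + t₂) * (s₁ + s₂) ^ (q - 1) := by
  have hq0 : q ≠ 0 := by linarith
  have hzero : ∀ {u t : ℝ}, 0 ≤ u → u ^ q ≤ t * (0 : ℝ) ^ (q - 1) → u = 0 := by
    intro u t hu h
    rw [Real.zero_rpow (by linarith), mul_zero] at h
    exact (Real.rpow_eq_zero hu hq0).1 (le_antisymm h (Real.rpow_nonneg hu _))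
  rcases hs₁.eq_or_lt with rfl | hs₁
  · rw [hzero hu₁ h₁, zero_add, zero_add]
    exact h₂.trans (mul_le_mul_of_nonneg_right (by linarith) (Real.rpow_nonneg hs₂ _))
  rcases hs₂.eq_or_lt with rfl | hs₂
  · rw [hzero hu₂ h₂, add_zero, add_zero]
    exact h₁.trans (mul_le_mul_of_nonneg_right (by linarith) (Real.rpow_nonneg hs₁.le _))
  set S := s₁ + s₂ with hS
  have hS0 : 0 < S := by positivity
  have hpow : ∀ {s : ℝ}, 0 < s → s ^ q = s ^ (q - 1) * s := fun hs => by
    rw [← Real.rpow_add_one hs.ne', sub_add_cancel]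
  have hquot : ∀ {u t s : ℝ}, 0 ≤ u → 0 < s → u ^ q ≤ t * s ^ (q - 1) → (u / s) ^ q ≤ t / s := by
    intro u t s hu hs h
    have : 0 < s ^ (q - 1) := Real.rpow_pos_of_pos hs _
    rw [Real.div_rpow hu hs.le, hpow hs, div_le_div_iff₀ (by positivity) hs]
    nlinarith
  have hconv := (convexOn_rpow hq.le).2
    (Set.mem_Ici.2 (show 0 ≤ u₁ / s₁ by positivity))
    (Set.mem_Ici.2 (show 0 ≤ u₂ / s₂ by positivity))
    (show 0 ≤ s₁ / S by positivity) (show 0 ≤ s₂ / S by positivity)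
    (by rw [← add_div, div_self hS0.ne'])
  simp only [smul_eq_mul] at hconv
  have e1 : s₁ / S * (u₁ / s₁) + s₂ / S * (u₂ / s₂) = (u₁ + u₂) / S := by field_simp
  rw [e1, Real.div_rpow (by positivity) hS0.le] at hconv
  have h3 : s₁ / S * (u₁ / s₁) ^ q + s₂ / S * (u₂ / s₂) ^ q ≤ (t₁ + t₂) / S := by
    have h4 := mul_le_mul_of_nonneg_left (hquot hu₁ hs₁ h₁) (show 0 ≤ s₁ / S by positivity)
    have h5 := mul_le_mul_of_nonneg_left (hquot hu₂ hs₂ h₂) (show 0 ≤ s₂ / S by positivity)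
    have e2 : s₁ / S * (t₁ / s₁) + s₂ / S * (t₂ / s₂) = (t₁ + t₂) / S := by field_simp
    linarith
  have h6 := hconv.trans h3
  have : 0 < S ^ (q - 1) := Real.rpow_pos_of_pos hS0 _
  rw [hpow hS0, div_le_div_iff₀ (by positivity) hS0] at h6
  refine le_of_mul_le_mul_right (h6.trans (le_of_eq ?_)) hS0
  ring

variable {N p : ℕ} (X : Matrix (Fin N) (Fin p) ℝ) (z : Euc N) {β q : ℝ} (j : Fin (2 * p))

/-- A division-free form of the epigraph: all three conditions are closed, and at the boundary `0 ^
(q - 1) = 0` forces `y = z`, so the separate case in the definition of `g` is absorbed. -/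
lemma gfun_le_coe_iff (hβ : 0 < β) (hq : 1 < q) (c : DataSp N) (t : ℝ) :
    gfun X z β q j c ≤ t ↔ ⟪xvec X j, z⟫_ℝ ≤ c.fst ∧ 0 ≤ t ∧
      ‖c.snd - z‖ ^ q ≤ β * t * (c.fst - ⟪xvec X j, z⟫_ℝ) ^ (q - 1) := by
  set a := ⟪xvec X j, z⟫_ℝ
  have hn : 0 ≤ ‖c.snd - z‖ ^ q := by positivity
  unfold gfun
  split_ifs with h1 h2
  · have hpos : 0 < (c.fst - a) ^ (q - 1) := Real.rpow_pos_of_pos (sub_pos.2 h1) _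
    rw [EReal.coe_le_coe_iff, div_le_iff₀ (by positivity)]
    constructor
    · intro h
      refine ⟨h1.le, ?_, by linarith⟩
      by_contra! ht
      have : 0 < β * (c.fst - a) ^ (q - 1) := by positivity
      nlinarith
    · rintro ⟨-, -, h⟩
      linarith
  · obtain ⟨hz, ha⟩ := h2
    rw [hz, ha, sub_self, sub_self, norm_zero, Real.zero_rpow (by linarith),
      Real.zero_rpow (by linarith)]
    simp [a]
  · simp only [top_le_iff, EReal.coe_ne_top, false_iff]
    rintro ⟨h3, -, h4⟩
    have ha : c.fst = a := le_antisymm (not_lt.1 h1) h3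
    rw [ha, sub_self, Real.zero_rpow (by linarith), mul_zero] at h4
    have := (Real.rpow_eq_zero (norm_nonneg _) (by linarith)).1 (le_antisymm h4 hn)
    exact h2 ⟨sub_eq_zero.1 (norm_eq_zero.1 this), ha⟩

lemma isNonnegClosedConvex_gfun (hβ : 0 < β) (hq : 1 < q) :
    IsNonnegClosedConvex (gfun X z β q j) where
  nonneg c := by
    unfold gfun
    split_ifs with h1 h2
    · have : 0 < c.fst - ⟪xvec X j, z⟫_ℝ := sub_pos.2 h1
      have : 0 ≤ ‖c.snd - z‖ ^ q / (β * (c.fst - ⟪xvec X j, z⟫_ℝ) ^ (q - 1)) := by positivity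
      exact_mod_cast this
    · exact le_rfl
    · exact le_top
  closed := by
    have hset : epi (gfun X z β q j) = {a : DataSp N × ℝ | ⟪xvec X j, z⟫_ℝ ≤ a.1.fst} ∩
        ({a | 0 ≤ a.2} ∩
        {a | ‖a.1.snd - z‖ ^ q ≤ β * a.2 * (a.1.fst - ⟪xvec X j, z⟫_ℝ) ^ (q - 1)}) := by
      ext a
      exact gfun_le_coe_iff X z j hβ hq a.1 a.2
    have hfst : Continuous fun a : DataSp N × ℝ => a.1.fst := by
      unfold WithLp.fst; fun_prop
    have hsnd : Continuous fun a : DataSp N × ℝ => a.1.snd := by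
      unfold WithLp.snd; fun_prop
    rw [hset]
    refine (isClosed_le continuous_const hfst).inter
      ((isClosed_le continuous_const continuous_snd).inter (isClosed_le ?_ ?_))
    · exact (hsnd.sub continuous_const).norm.rpow_const fun _ => Or.inr (by linarith)
    · exact (continuous_const.mul continuous_snd).mul
        ((hfst.sub continuous_const).rpow_const fun _ => Or.inr (by linarith))
  proper := by
    refine ⟨WithLp.toLp 2 (⟪xvec X j, z⟫_ℝ, z), ?_⟩
    have := (gfun_le_coe_iff X z j hβ hq (WithLp.toLp 2 (⟪xvec X j, z⟫_ℝ, z)) 0).2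
      ⟨le_rfl, le_rfl, by simp [Real.zero_rpow (show q ≠ 0 by linarith)]⟩
    exact ne_top_of_le_ne_top (EReal.coe_ne_top 0) this
  convex := by
    rintro ⟨c₁, t₁⟩ h₁ ⟨c₂, t₂⟩ h₂ a b ha hb hab
    obtain ⟨hs₁, ht₁, h₁⟩ := (gfun_le_coe_iff X z j hβ hq c₁ t₁).1 h₁
    obtain ⟨hs₂, ht₂, h₂⟩ := (gfun_le_coe_iff X z j hβ hq c₂ t₂).1 h₂
    refine (gfun_le_coe_iff X z j hβ hq (a • c₁ + b • c₂) (a • t₁ + b • t₂)).2 ?_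
    set m := ⟪xvec X j, z⟫_ℝ
    have hb' : b = 1 - a := by linarith
    have hfst : (a • c₁ + b • c₂).fst - m = a * (c₁.fst - m) + b * (c₂.fst - m) := by
      simp only [WithLp.add_fst, WithLp.smul_fst, smul_eq_mul, hb']; ring
    have hsnd : (a • c₁ + b • c₂).snd - z = a • (c₁.snd - z) + b • (c₂.snd - z) := by
      simp only [WithLp.add_snd, WithLp.smul_snd, hb']; module
    have hs₁' := mul_nonneg ha (sub_nonneg.2 hs₁)
    have hs₂' := mul_nonneg hb (sub_nonneg.2 hs₂)
    refine ⟨?_, ?_, ?_⟩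
    · linarith
    · simp only [smul_eq_mul]; positivity
    · rw [hfst, hsnd]
      have hnorm : ‖a • (c₁.snd - z) + b • (c₂.snd - z)‖ ≤
          a * ‖c₁.snd - z‖ + b * ‖c₂.snd - z‖ := by
        refine (norm_add_le _ _).trans (le_of_eq ?_)
        rw [norm_smul, norm_smul, Real.norm_of_nonneg ha, Real.norm_of_nonneg hb]
      have e : β * (a • t₁ + b • t₂) = a * (β * t₁) + b * (β * t₂) := by
        simp only [smul_eq_mul]; ring
      rw [e]
      refine (Real.rpow_le_rpow (norm_nonneg _) hnorm (by linarith)).trans ?_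
      exact rpow_le_mul_rpow_add hq (by positivity) (by positivity) hs₁'
        (rpow_le_mul_rpow_smul ha hq (norm_nonneg _) (sub_nonneg.2 hs₁) h₁)
        (by positivity) (by positivity) hs₂'
        (rpow_le_mul_rpow_smul hb hq (norm_nonneg _) (sub_nonneg.2 hs₂) h₂)

end Perspective

/-! ### Slater point and projection onto the graph of `M_j` -/

section DouglasRachford

variable {N p : ℕ} (X : Matrix (Fin N) (Fin p) ℝ) (z : Euc N) {β q : ℝ} (j : Fin (2 * p))

lemma Mop_fst (b : Euc p) : (Mop X j b).fst = ⟪xvec X j, X.toEuclideanLin b⟫_ℝ := rfl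

lemma exists_toEuclideanLin_eq_xvec : ∃ e : Euc p, X.toEuclideanLin e = xvec X j := by
  have hcol : ∀ k : Fin p,
      X.toEuclideanLin (EuclideanSpace.single k 1) = WithLp.toLp 2 (X.col k) := fun k => by
    ext i
    simp [Matrix.toLpLin_apply]
  unfold xvec
  split_ifs with h
  · exact ⟨_, hcol _⟩
  · exact ⟨-EuclideanSpace.single _ 1, by rw [map_neg, hcol]⟩

lemma xvec_ne_zero (hX : ∀ k : Fin p, X.col k ≠ 0) : xvec X j ≠ 0 := by
  have hcol : ∀ k : Fin p, WithLp.toLp 2 (X.col k) ≠ 0 := fun k h => hX k (by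
    simpa using h)
  unfold xvec
  split_ifs with h
  · exact hcol _
  · exact neg_ne_zero.2 (hcol _)

/-- Slater's condition for the composition of `g_(j,q)` with `M_j`. -/
lemma exists_slater_point (hβ : 0 < β) (hq : 1 < q) (hX : ∀ k : Fin p, X.col k ≠ 0) :
    ∃ (b₀ : Euc p) (G : ℝ), ∀ y, ‖y‖ ≤ 1 → gfun X z β q j (Mop X j b₀ + y) ≤ G := by
  obtain ⟨e, he⟩ := exists_toEuclideanLin_eq_xvec X j
  have hx : 0 < ‖xvec X j‖ ^ 2 := by have := norm_pos_iff.2 (xvec_ne_zero X j hX); positivity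
  set a := ⟪xvec X j, z⟫_ℝ with ha
  -- Scaled so that the first coordinate of `M b₀` exceeds the threshold by `2`: a unit perturbation
  -- leaves a margin of at least `1`, where the denominator power is at least `1`.
  set b₀ : Euc p := ((a + 2) / ‖xvec X j‖ ^ 2) • e
  have hb₀ : (Mop X j b₀).fst = a + 2 := by
    rw [Mop_fst, map_smul, he, real_inner_smul_right, real_inner_self_eq_norm_sq,
      div_mul_cancel₀ _ hx.ne']
  set n := ‖(Mop X j b₀).snd - z‖
  refine ⟨b₀, (n + 1) ^ q / β, fun y hy => ?_⟩
  have hsq := WithLp.prod_norm_sq_eq_of_L2 y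
  have hy1 : |y.fst| ≤ 1 := by
    rw [← Real.norm_eq_abs]
    refine le_trans ?_ hy
    rw [← sq_le_sq₀ (norm_nonneg _) (norm_nonneg _), hsq]
    nlinarith [sq_nonneg ‖y.snd‖]
  have hy2 : ‖y.snd‖ ≤ 1 := by
    refine le_trans ?_ hy
    rw [← sq_le_sq₀ (norm_nonneg _) (norm_nonneg _), hsq]
    nlinarith [sq_nonneg ‖y.fst‖]
  have hn : 0 ≤ n := norm_nonneg _
  rw [gfun_le_coe_iff X z j hβ hq, ← ha, WithLp.add_fst, WithLp.add_snd, hb₀]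
  have := (abs_le.1 hy1).1
  refine ⟨by linarith, by positivity, ?_⟩
  have h1 : ‖(Mop X j b₀).snd + y.snd - z‖ ≤ n + 1 := by
    have e : (Mop X j b₀).snd + y.snd - z = ((Mop X j b₀).snd - z) + y.snd := by abel
    rw [e]
    exact (norm_add_le _ _).trans (by linarith)
  have h2 : (1 : ℝ) ≤ (a + 2 + y.fst - a) ^ (q - 1) :=
    Real.one_le_rpow (by linarith) (by linarith)
  rw [mul_div_cancel₀ _ hβ.ne']
  exact (Real.rpow_le_rpow (norm_nonneg _) h1 (by linarith)).trans
    (le_mul_of_one_le_right (by positivity) h2)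

lemma add_comp_adjoint_resolventInv (c : DataSp N) :
    resolventInv X j c + Mop X j ((Mop X j).adjoint (resolventInv X j c)) = c := by
  have := Ring.mul_inverse_cancel _ (isUnit_one_add_comp_adjoint X j)
  exact DFunLike.congr_fun this c

lemma resolventInv_add_comp_adjoint (c : DataSp N) :
    resolventInv X j (c + Mop X j ((Mop X j).adjoint c)) = c := by
  have := Ring.inverse_mul_cancel _ (isUnit_one_add_comp_adjoint X j)
  exact DFunLike.congr_fun this c

/-- Self-adjointness of the inverse `R`: substituting `c = R c + M M* R c`, and likewise for `d`,
makes both sides symmetric in `R c` and `R d`. -/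
lemma inner_resolventInv_left (c d : DataSp N) :
    ⟪resolventInv X j c, d⟫_ℝ = ⟪c, resolventInv X j d⟫_ℝ := by
  conv_lhs => rw [← add_comp_adjoint_resolventInv X j d]
  conv_rhs => rw [← add_comp_adjoint_resolventInv X j c]
  rw [inner_add_left, inner_add_right, ← ContinuousLinearMap.adjoint_inner_left (Mop X j),
    ← ContinuousLinearMap.adjoint_inner_right (Mop X j)]

/-- The dual component of the projection onto the graph of `M_j`. -/
def dualPart (w : ProdSp N p) : DataSp N := resolventInv X j (Mop X j w.fst - w.snd)

lemma fst_eq (w : ProdSp N p) : w.fst = Xi X j w + (Mop X j).adjoint (dualPart X j w) := by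
  simp [Xi, dualPart]

lemma snd_eq (w : ProdSp N p) : w.snd = Mop X j (Xi X j w) - dualPart X j w := by
  have h := add_comp_adjoint_resolventInv X j (Mop X j w.fst - w.snd)
  change dualPart X j w + Mop X j ((Mop X j).adjoint (dualPart X j w)) = _ at h
  have e : Mop X j (Xi X j w) = Mop X j w.fst - Mop X j ((Mop X j).adjoint (dualPart X j w)) := by
    rw [Xi, map_sub]; rfl
  rw [e, sub_sub, add_comm _ (dualPart X j w), h, sub_sub_cancel]

end DouglasRachford

/-! ### Fixed points of the splitting operator as primal–dual pairs -/

section FixedPoints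

variable {N p : ℕ} (X : Matrix (Fin N) (Fin p) ℝ) (z : Euc N) {β q : ℝ} (j : Fin (2 * p))

/-- `Xi` as a continuous linear map. -/
def XiL : ProdSp N p →L[ℝ] Euc p :=
  WithLp.fstL 2 ℝ (Euc p) (DataSp N) - (Mop X j).adjoint ∘L resolventInv X j ∘L
    (Mop X j ∘L WithLp.fstL 2 ℝ (Euc p) (DataSp N) - WithLp.sndL 2 ℝ (Euc p) (DataSp N))

lemma XiL_apply (w : ProdSp N p) : XiL X j w = Xi X j w := rfl

/-- Identifies the algorithm's correction with the gradient of `Ψ ∘ Xi`, which is `Xi* ∘ ∇Ψ ∘ Xi`.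
-/
lemma XiL_adjoint_apply (g : Euc p) : (XiL X j).adjoint g = WithLp.toLp 2
    (g - (Mop X j).adjoint (resolventInv X j (Mop X j g)), resolventInv X j (Mop X j g)) := by
  refine ext_inner_right ℝ fun w => ?_
  rw [ContinuousLinearMap.adjoint_inner_left, XiL_apply, WithLp.prod_inner_apply, Xi]
  change _ = ⟪g - (Mop X j).adjoint (resolventInv X j (Mop X j g)), w.fst⟫_ℝ +
    ⟪resolventInv X j (Mop X j g), w.snd⟫_ℝ
  rw [inner_sub_right, inner_sub_left, ContinuousLinearMap.adjoint_inner_left,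
    ContinuousLinearMap.adjoint_inner_right, ← inner_resolventInv_left, inner_sub_right]
  ring

/-- The reflection across the graph of `M_j` preserves the norm. -/
lemma norm_sq_eq_reflect (w : ProdSp N p) :
    ‖w‖ ^ 2 = ‖(2 : ℝ) • Xi X j w - w.fst‖ ^ 2 + ‖(2 : ℝ) • Mop X j (Xi X j w) - w.snd‖ ^ 2 := by
  set b := Xi X j w with hb
  set u := dualPart X j w
  have e1 : (2 : ℝ) • b - w.fst = b - (Mop X j).adjoint u := by rw [fst_eq X j w]; module
  have e2 : (2 : ℝ) • Mop X j b - w.snd = Mop X j b + u := by rw [snd_eq X j w]; module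
  rw [WithLp.prod_norm_sq_eq_of_L2, e1, e2, fst_eq X j w, snd_eq X j w, norm_add_sq_real,
    norm_sub_sq_real, norm_add_sq_real, norm_sub_sq_real, ContinuousLinearMap.adjoint_inner_right]
  ring

lemma TDRS_fst (w : ProdSp N p) : (TDRS X z β q j w).fst =
    (2 : ℝ) • prox (fun b : Euc p => (l1 b : EReal)) ((2 : ℝ) • Xi X j w - w.fst) -
      ((2 : ℝ) • Xi X j w - w.fst) := rfl

lemma TDRS_snd (w : ProdSp N p) : (TDRS X z β q j w).snd =
    (2 : ℝ) • prox (gfun X z β q j) ((2 : ℝ) • Mop X j (Xi X j w) - w.snd) -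
      ((2 : ℝ) • Mop X j (Xi X j w) - w.snd) := rfl

lemma lipschitzWith_TDRS (hβ : 0 < β) (hq : 1 < q) : LipschitzWith 1 (TDRS X z β q j) := by
  refine LipschitzWith.of_dist_le_mul fun w w' => ?_
  rw [NNReal.coe_one, one_mul, dist_eq_norm, dist_eq_norm,
    ← sq_le_sq₀ (norm_nonneg _) (norm_nonneg _), WithLp.prod_norm_sq_eq_of_L2,
    norm_sq_eq_reflect X j (w - w')]
  have hXi : Xi X j (w - w') = Xi X j w - Xi X j w' := by
    simp only [← XiL_apply, map_sub]
  have e1 : (2 : ℝ) • Xi X j (w - w') - (w - w').fst =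
      ((2 : ℝ) • Xi X j w - w.fst) - ((2 : ℝ) • Xi X j w' - w'.fst) := by
    rw [hXi, WithLp.sub_fst]; module
  have e2 : (2 : ℝ) • Mop X j (Xi X j (w - w')) - (w - w').snd =
      ((2 : ℝ) • Mop X j (Xi X j w) - w.snd) - ((2 : ℝ) • Mop X j (Xi X j w') - w'.snd) := by
    rw [hXi, WithLp.sub_snd, map_sub]; module
  rw [e1, e2, WithLp.sub_fst, WithLp.sub_snd, TDRS_fst, TDRS_fst, TDRS_snd, TDRS_snd]
  exact add_le_add
    (pow_le_pow_left₀ (norm_nonneg _) (isNonnegClosedConvex_l1.norm_reflect_sub_le _ _) 2)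
    (pow_le_pow_left₀ (norm_nonneg _)
      ((isNonnegClosedConvex_gfun X z j hβ hq).norm_reflect_sub_le _ _) 2)

/-- `b` and `u` are primal and dual solutions of the `j`-th subproblem. -/
def IsPrimalDual (β q : ℝ) (b : Euc p) (u : DataSp N) : Prop :=
  IsSubgrad (gfun X z β q j) (Mop X j b) u ∧
    ∀ w, l1 b + ⟪-(Mop X j).adjoint u, w - b⟫_ℝ ≤ l1 w

/-- In each component the fixed point equation reads `2 prox (a + v) - (a + v) = a - v`, that is
`prox (a + v) = a`, or `v ∈ ∂f(a)`. Here `v` is `-M* u` for the `ℓ₁` norm and `u` for `g`. -/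
lemma mem_fixedPoints_TDRS_iff (hβ : 0 < β) (hq : 1 < q) (w : ProdSp N p) :
    w ∈ Function.fixedPoints (TDRS X z β q j) ↔
      IsPrimalDual X z j β q (Xi X j w) (dualPart X j w) := by
  set b := Xi X j w with hb
  set u := dualPart X j w
  have e1 : (2 : ℝ) • b - w.fst = b - (Mop X j).adjoint u := by rw [fst_eq X j w]; module
  have e2 : (2 : ℝ) • Mop X j b - w.snd = Mop X j b + u := by rw [snd_eq X j w]; module
  have hfix : w ∈ Function.fixedPoints (TDRS X z β q j) ↔
      (TDRS X z β q j w).fst = w.fst ∧ (TDRS X z β q j w).snd = w.snd := by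
    rw [Function.mem_fixedPoints, Function.IsFixedPt]
    refine ⟨fun h => by rw [h]; exact ⟨rfl, rfl⟩, fun h => ?_⟩
    exact WithLp.ofLp_injective 2 (Prod.ext h.1 h.2)
  have h2 : ∀ {H : Type _} [AddCommGroup H] [Module ℝ H] (y a v : H),
      (2 : ℝ) • y - (a + v) = a - v ↔ y = a := by
    intro H _ _ y a v
    rw [sub_eq_iff_eq_add, show a - v + (a + v) = (2 : ℝ) • a by module]
    exact smul_right_inj two_ne_zero
  rw [hfix, TDRS_fst, TDRS_snd, ← hb, e1, e2]
  conv_lhs => rw [fst_eq X j w, snd_eq X j w, ← hb]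
  have h3 := h2 (prox (fun b : Euc p => (l1 b : EReal)) (b - (Mop X j).adjoint u)) b
    (-(Mop X j).adjoint u)
  rw [← sub_eq_add_neg, sub_neg_eq_add] at h3
  rw [h3, h2, isNonnegClosedConvex_l1.prox_eq_iff,
    (isNonnegClosedConvex_gfun X z j hβ hq).prox_eq_iff, isSubgrad_l1_iff, IsPrimalDual,
    sub_sub_cancel_left, add_sub_cancel_left, and_comm]

lemma exists_fixedPoint_of_isPrimalDual (hβ : 0 < β) (hq : 1 < q) {b : Euc p} {u : DataSp N}
    (h : IsPrimalDual X z j β q b u) :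
    ∃ w ∈ Function.fixedPoints (TDRS X z β q j), Xi X j w = b := by
  set w : ProdSp N p := WithLp.toLp 2 (b + (Mop X j).adjoint u, Mop X j b - u) with hw
  have hu : dualPart X j w = u := by
    have e : Mop X j w.fst - w.snd = u + Mop X j ((Mop X j).adjoint u) := by
      change Mop X j (b + (Mop X j).adjoint u) - (Mop X j b - u) = _
      rw [map_add]; abel
    rw [dualPart, e, resolventInv_add_comp_adjoint]
  have hb : Xi X j w = b := by
    have := fst_eq X j w
    rw [hu] at this
    exact (add_right_cancel this).symm
  refine ⟨w, ?_, hb⟩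
  rw [mem_fixedPoints_TDRS_iff X z j hβ hq, hb, hu]
  exact h

lemma exists_gfun_Mop_ne_top {b₀ : Euc p} {G : ℝ}
    (hslater : ∀ y, ‖y‖ ≤ 1 → gfun X z β q j (Mop X j b₀ + y) ≤ G) :
    ∃ b, gfun X z β q j (Mop X j b) ≠ ⊤ :=
  ⟨b₀, ne_top_of_le_ne_top (EReal.coe_ne_top G) (by simpa using hslater 0 (by simp))⟩

/-- Existence of `u` is strong duality from the Slater point; conversely, adding the two subgradient
inequalities cancels the inner products. -/
lemma mem_solSet_iff (hβ : 0 < β) (hq : 1 < q) (hX : ∀ k : Fin p, X.col k ≠ 0) (b : Euc p) :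
    b ∈ solSet X z β q j ↔ ∃ u, IsPrimalDual X z j β q b u := by
  obtain ⟨b₀, G, hslater⟩ := exists_slater_point X z j hβ hq hX
  have hg := isNonnegClosedConvex_gfun X z j hβ hq
  rw [solSet, mem_argminSet_add_iff (f := fun b => gfun X z β q j (Mop X j b))
    (fun b => hg.nonneg _) (exists_gfun_Mop_ne_top X z j hslater)]
  constructor
  · rintro ⟨r, hr, H⟩
    exact exists_isSubgrad_of_minimizer hg convexOn_l1 (Mop X j) one_pos hslater hr H
  · rintro ⟨u, ⟨r, hr, H⟩, H'⟩
    refine ⟨r, hr, fun w t hw => ?_⟩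
    have h1 := H _ _ hw
    have h2 := H' w
    rw [inner_neg_left, ContinuousLinearMap.adjoint_inner_left, map_sub] at h2
    linarith

lemma solSet_nonempty (hβ : 0 < β) (hq : 1 < q) (hX : ∀ k : Fin p, X.col k ≠ 0) :
    (solSet X z β q j).Nonempty := by
  obtain ⟨b₀, G, hslater⟩ := exists_slater_point X z j hβ hq hX
  have hg := isNonnegClosedConvex_gfun X z j hβ hq
  refine argminSet_add_nonempty (f := fun b => gfun X z β q j (Mop X j b)) (fun b => hg.nonneg _)
    ?_ (exists_gfun_Mop_ne_top X z j hslater) continuous_l1 l1_nonneg isBounded_l1_le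
  exact hg.closed.preimage (((Mop X j).continuous.comp continuous_fst).prodMk continuous_snd)

lemma image_Xi_fixedPoints (hβ : 0 < β) (hq : 1 < q) (hX : ∀ k : Fin p, X.col k ≠ 0) :
    Xi X j '' Function.fixedPoints (TDRS X z β q j) = solSet X z β q j := by
  ext b
  rw [mem_solSet_iff X z j hβ hq hX]
  constructor
  · rintro ⟨w, hw, rfl⟩
    exact ⟨_, (mem_fixedPoints_TDRS_iff X z j hβ hq w).1 hw⟩
  · rintro ⟨u, hu⟩
    exact exists_fixedPoint_of_isPrimalDual X z j hβ hq hu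

lemma isBounded_fixedPoints (hβ : 0 < β) (hq : 1 < q) (hX : ∀ k : Fin p, X.col k ≠ 0) :
    Bornology.IsBounded (Function.fixedPoints (TDRS X z β q j)) := by
  obtain ⟨b₀, G, hslater⟩ := exists_slater_point X z j hβ hq hX
  have hg := isNonnegClosedConvex_gfun X z j hβ hq
  set R := G + l1 b₀
  let f : Euc p × DataSp N → ProdSp N p := fun a =>
    WithLp.toLp 2 (a.1 + (Mop X j).adjoint a.2, Mop X j a.1 - a.2)
  have hf : Continuous f := by
    refine (WithLp.prod_continuous_toLp 2 _ _).comp ?_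
    fun_prop
  refine (((isCompact_closedBall (0 : Euc p) R).prod
    (isCompact_closedBall (0 : DataSp N) R)).image hf).isBounded.subset fun w hw => ?_
  obtain ⟨hsub, hl1⟩ := (mem_fixedPoints_TDRS_iff X z j hβ hq w).1 hw
  -- One radius serves both factors: the value at the Slater point bounds the primal `ℓ₁` norm by
  -- optimality, and the dual norm because the Slater ball has radius one.
  refine ⟨(Xi X j w, dualPart X j w), ⟨?_, ?_⟩, ?_⟩
  · rw [mem_closedBall_zero_iff]
    refine (norm_le_l1 _).trans ?_
    obtain ⟨r, hr, H⟩ := hsub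
    have hr0 : 0 ≤ r := by
      have := hg.nonneg (Mop X j (Xi X j w)); rw [hr] at this; exact_mod_cast this
    have h1 := H _ _ (by simpa using hslater 0 (by simp))
    have h2 := hl1 b₀
    rw [inner_neg_left, ContinuousLinearMap.adjoint_inner_left, map_sub] at h2
    linarith
  · rw [mem_closedBall_zero_iff, ← one_mul ‖_‖]
    exact norm_mul_le_of_isSubgrad (Mop X j) one_pos hslater hg.nonneg l1_nonneg hsub hl1
  · exact WithLp.ofLp_injective 2 (Prod.ext (fst_eq X j w).symm (snd_eq X j w).symm)

end FixedPoints

/-! ### Gâteaux gradients: chain rule and the convexity inequality -/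

section Gradient

variable {E F : Type*} [NormedAddCommGroup E] [InnerProductSpace ℝ E] [CompleteSpace E]
  [NormedAddCommGroup F] [InnerProductSpace ℝ F] [CompleteSpace F]

lemma IsGateauxGradient.comp_continuousLinearMap {f : F → ℝ} {G : F → F}
    (h : IsGateauxGradient f G) (L : E →L[ℝ] F) :
    IsGateauxGradient (fun w => f (L w)) (fun w => L.adjoint (G (L w))) := by
  intro x v
  have := h (L x) (L v)
  rw [HasLineDerivAt] at this ⊢
  simpa only [map_add, map_smul, ContinuousLinearMap.adjoint_inner_left] using this

lemma IsGateauxGradient.add_inner_le {E : Type*} [NormedAddCommGroup E]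
    [InnerProductSpace ℝ E] {f : E → ℝ} {G : E → E} (h : IsGateauxGradient f G)
    (hf : ConvexOn ℝ Set.univ f) (x y : E) : f x + ⟪G x, y - x⟫_ℝ ≤ f y := by
  have h1 : HasDerivAt (fun t : ℝ => f (x + t • (y - x))) ⟪G x, y - x⟫_ℝ 0 := h x (y - x)
  have hconv : ConvexOn ℝ Set.univ (fun t : ℝ => f (x + t • (y - x))) := by
    refine ⟨convex_univ, fun s _ t _ a b ha hb hab => ?_⟩
    have := hf.2 (Set.mem_univ (x + s • (y - x))) (Set.mem_univ (x + t • (y - x))) ha hb hab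
    have e : x + (a • s + b • t) • (y - x) = a • (x + s • (y - x)) + b • (x + t • (y - x)) := by
      have hb' : b = 1 - a := by linarith
      subst hb'
      simp only [smul_eq_mul]
      module
    simp only [e]
    exact this
  have := hconv.le_slope_of_hasDerivAt (Set.mem_univ 0) (Set.mem_univ 1) one_pos h1
  simp [slope_def_field] at this
  linarith

end Gradient

end HTREX

end

/-! ### The main theorem -/

open HTREX Filter Topology in
theorem theorem6 {N p : ℕ} (X : Matrix (Fin N) (Fin p) ℝ) (z : HTREX.Euc N) (β q : ℝ)
    (hβ : 0 < β) (hq : 1 < q) (hX : ∀ k : Fin p, X.col k ≠ 0)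
    (Ψ : HTREX.Euc p → ℝ) (gradΨ : HTREX.Euc p → HTREX.Euc p)
    (hΨ : ConvexOn ℝ Set.univ Ψ) (hgrad : IsGateauxGradient Ψ gradΨ)
    (hLip : ∃ κ : NNReal, LipschitzWith κ gradΨ)
    (j : Fin (2 * p)) :
    -- (a)
    Bornology.IsBounded (Function.fixedPoints (TDRS X z β q j)) ∧
    -- (b)
    LipschitzWith 1 (TDRS X z β q j) ∧
    (Function.fixedPoints (TDRS X z β q j)).Nonempty ∧
    (omegaSet X z β q Ψ j).Nonempty ∧
    ∃ gradΘ : ProdSp N p → ProdSp N p,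
      IsGateauxGradient (fun w => Ψ (Xi X j w)) gradΘ ∧
      ∀ α : ℝ, 0 < α → α < 1 →
      ∀ lam : ℕ → ℝ, (∀ n, 0 ≤ lam (n + 1)) →
        Summable (fun n => lam (n + 1) ^ 2) → ¬ Summable (fun n => lam (n + 1)) →
      ∀ w₀ : ProdSp N p,
        (∀ n, iter X z β q α lam gradΨ j w₀ (n + 1) =
          TAvg X z β q α j (iter X z β q α lam gradΨ j w₀ n) -
            lam (n + 1) • gradΘ (TAvg X z β q α j (iter X z β q α lam gradΨ j w₀ n))) ∧
        Tendsto (fun n => Metric.infDist (bstarSucc X z β q α lam gradΨ j w₀ n)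
          (omegaSet X z β q Ψ j)) atTop (𝓝 0) := by
  have hT := lipschitzWith_TDRS X z j hβ hq
  have hbd := isBounded_fixedPoints X z j hβ hq hX
  have himg := image_Xi_fixedPoints X z j hβ hq hX
  have hne : (Function.fixedPoints (TDRS X z β q j)).Nonempty := by
    have := solSet_nonempty X z j hβ hq hX
    rw [← himg] at this
    exact this.of_image
  have hcpt : IsCompact (Function.fixedPoints (TDRS X z β q j)) :=
    Metric.isCompact_of_isClosed_isBounded (isClosed_fixedPoints hT.continuous) hbd
  have hΨc : Continuous Ψ := continuousOn_univ.1 (hΨ.continuousOn isOpen_univ)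
  have hΘ : Continuous fun w => Ψ (Xi X j w) := hΨc.comp (XiL X j).continuous
  set Γ : Set (ProdSp N p) := {w | w ∈ Function.fixedPoints (TDRS X z β q j) ∧
    ∀ y ∈ Function.fixedPoints (TDRS X z β q j), Ψ (Xi X j w) ≤ Ψ (Xi X j y)} with hΓ
  have hΓne : Γ.Nonempty := by
    obtain ⟨w, hw, hmin⟩ := hcpt.exists_isMinOn hne hΘ.continuousOn
    exact ⟨w, hw, hmin⟩
  have hΓΩ : ∀ w ∈ Γ, Xi X j w ∈ omegaSet X z β q Ψ j := by
    rintro w ⟨hw, hmin⟩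
    refine ⟨himg ▸ Set.mem_image_of_mem _ hw, fun b hb => ?_⟩
    rw [← himg] at hb
    obtain ⟨y, hy, rfl⟩ := hb
    exact hmin y hy
  have hgradΘ := hgrad.comp_continuousLinearMap (XiL X j)
  refine ⟨hbd, hT, hne, ?_, _, hgradΘ, ?_⟩
  · obtain ⟨w, hw⟩ := hΓne
    exact ⟨_, hΓΩ w hw⟩
  intro α hα0 hα1 lam hlam hlam2 hlam1 w₀
  have hiter : ∀ n, iter X z β q α lam gradΨ j w₀ (n + 1) =
      TAvg X z β q α j (iter X z β q α lam gradΨ j w₀ n) - lam (n + 1) •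
        (XiL X j).adjoint
          (gradΨ (XiL X j (TAvg X z β q α j (iter X z β q α lam gradΨ j w₀ n)))) := by
    intro n
    rw [XiL_adjoint_apply]
    rfl
  refine ⟨hiter, ?_⟩
  have hfix : ∀ w ∈ Function.fixedPoints (TDRS X z β q j), TAvg X z β q α j w = w := by
    intro w hw
    rw [TAvg, Function.mem_fixedPoints.1 hw]
    module
  have hS : LipschitzWith 1 (TAvg X z β q α j) := by
    refine LipschitzWith.of_dist_le_mul fun w w' => ?_
    have h1 := hT.norm_sub_le w w'
    rw [NNReal.coe_one, one_mul] at h1 ⊢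
    rw [dist_eq_norm, dist_eq_norm]
    have e : TAvg X z β q α j w - TAvg X z β q α j w' =
        (1 - α) • (w - w') + α • (TDRS X z β q j w - TDRS X z β q j w') := by
      simp only [TAvg]; module
    rw [e]
    refine (norm_add_le _ _).trans ?_
    rw [norm_smul, norm_smul, Real.norm_of_nonneg hα0.le, Real.norm_of_nonneg (by linarith)]
    have := mul_le_mul_of_nonneg_left h1 hα0.le
    linarith
  have hstrict : ∀ w ∉ Function.fixedPoints (TDRS X z β q j),
      ∀ y ∈ Function.fixedPoints (TDRS X z β q j),
        dist (TAvg X z β q α j w) y < dist w y := by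
    intro w hw y hy
    have h1 := norm_average_sub_sq_le hT hα0.le (x := w) (y := y) hy
    have h2 : 0 < ‖TDRS X z β q j w - w‖ :=
      norm_pos_iff.2 (sub_ne_zero.2 fun h => hw h)
    have h3 : 0 < α * (1 - α) * ‖TDRS X z β q j w - w‖ ^ 2 :=
      mul_pos (mul_pos hα0 (by linarith)) (by positivity)
    rw [dist_eq_norm, dist_eq_norm, ← sq_lt_sq₀ (norm_nonneg _) (norm_nonneg _)]
    exact h1.trans_lt (by linarith)
  obtain ⟨κ, hκ⟩ := hLip
  have hLipΘ := ((XiL X j).adjoint.lipschitz.comp hκ).comp (XiL X j).lipschitz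
  have hsub : ∀ x y : ProdSp N p, Ψ (Xi X j x) +
      inner ℝ ((XiL X j).adjoint (gradΨ (XiL X j x))) (y - x) ≤ Ψ (Xi X j y) := by
    intro x y
    rw [ContinuousLinearMap.adjoint_inner_left, map_sub]
    exact hgrad.add_inner_le hΨ _ _
  -- The step sizes enter as `n ↦ lam (n + 1)`, so `lam 0` plays no role.
  have hlim := tendsto_infDist_hybridSteepestDescent hS hcpt hfix hstrict hΘ hLipΘ hsub
    (Γ := Γ) (fun x => Iff.rfl) hΓne hlam hlam2 hlam1 hiter
  have hlim' := hlim.const_mul ‖XiL X j‖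
  rw [mul_zero] at hlim'
  refine squeeze_zero (fun n => Metric.infDist_nonneg) (fun n => ?_) hlim'
  have hΓc : IsCompact Γ := by
    have e : Γ = Function.fixedPoints (TDRS X z β q j) ∩
        ⋂ y ∈ Function.fixedPoints (TDRS X z β q j), {w | Ψ (Xi X j w) ≤ Ψ (Xi X j y)} := by
      ext w
      simp [hΓ]
    rw [e]
    exact hcpt.inter_right
      (isClosed_biInter fun y _ => isClosed_le hΘ continuous_const)
  -- The output is `Xi` of the averaged map at the iterate, and `y` is fixed by that map, so its
  -- distance to `Xi y ∈ Ω` is at most `‖Xi‖` times the distance of the iterate to `Γ`.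
  obtain ⟨y, hy, hxy⟩ := hΓc.exists_infDist_eq_dist hΓne (iter X z β q α lam gradΨ j w₀ n)
  refine (Metric.infDist_le_dist_of_mem (hΓΩ y hy)).trans ?_
  rw [hxy, bstarSucc, ← XiL_apply, ← XiL_apply, dist_eq_norm, ← map_sub]
  refine ((XiL X j).le_opNorm _).trans (mul_le_mul_of_nonneg_left ?_ (norm_nonneg _))
  have h1 := hS.dist_le_mul (iter X z β q α lam gradΨ j w₀ n) y
  rwa [hfix y hy.1, NNReal.coe_one, one_mul, dist_eq_norm] at h1
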